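/- Let $n\ge 1$, and let $D_n$ be the group of all linear isometries of $\mathbb{R}^n$ of the form $(gx)_i=\varepsilon_i x_{\sigma(i)}$, where $\sigma$ is a permutation of $\{1,\dots,n\}$ and $\varepsilon\in\{1,-1\}^n$ satisfies $\prod_i\varepsilon_i=1$. Its reflection arrangement $\mathcal{D}_n$ consists of the hyperplanes $\{x_i=x_j\}$ and $\{x_i=-x_j\}$, $1\le i<j\le n$. Let $L$ be the set of all intersections of subfamilies of $\mathcal{D}_n$ (including $\mathbb{R}^n$ as the empty intersection), ordered by reverse inclusion, let $\mu$ be the Möbius function defined by $\mu(\mathbb{R}^n)=1$ and $\sum_{z\in L,\, z\le y}\mu(z)=0$ for $y\in L\setminus\{\mathbb{R}^n\}$, and let $$\chi^D_n(t)=\sum_{y\in L}\mu(y)\,t^{\dim y}$$ be the characteristic polynomial of $\mathcal{D}_n$. Then $$\chi^D_n(t)=(t-1)(t-3)\cdots(t-2n+3)\cdot(t-n+1)$$ (for $n=1$ the product $(t-1)(t-3)\cdots(t-2n+3)$ is empty, so $\chi^D_1(t)=t$). A fundamental chamber $\mathcal{C}$ of $D_n$ is the closure of a connected component of the complement of $\bigcup_{H\in\mathcal{D}_n}H$.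 Let $\pi_{\mathcal{C}}$ denote the (unweighted) orthogonal projection, that is, $\pi_{\mathcal{C}}(y)$ is the point of $\mathcal{C}$ nearest to $y$ in the Euclidean norm. Call $\pi_{\mathcal{C}}(y)$ $k$-dimensional if it lies in the relative interior of a $k$-dimensional face of $\mathcal{C}$ (with $\mathcal{C}$ counted as a face of itself). For every fundamental chamber $\mathcal{C}$ of $D_n$, every generic point $x\in\mathcal{C}$ and every integer $k\ge 0$, $$\#\{g\in D_n : \pi_{\mathcal{C}}(gx)\text{ is } k\text{-dimensional}\}=\bigl|[t^k]\,\chi^D_n(t)\bigr|.$$ Here "generic" means: there is a finite collection of proper linear subspaces of $\mathbb{R}^n$, depending only on $n$, such that the equality holds for all $\mathcal{C}$, $k$ and all $x\in\mathcal{C}$ lying in none of these subspaces. -/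

import Mathlib

open Polynomial

noncomputable section

namespace CoxeterD

/-- Euclidean `n`-space with its standard inner product. -/
abbrev E (n : ℕ) : Type := EuclideanSpace ℝ (Fin n)

section Arrangement

variable {n : ℕ}

open Classical in
/-- The intersection lattice of a finite central arrangement `𝓐`: all intersections of
subfamilies of `𝓐`, the empty one giving the whole space, ordered by reverse inclusion. -/
def intersections (𝓐 : Finset (Submodule ℝ (E n))) : Finset (Submodule ℝ (E n))ᵒᵈ :=
  𝓐.powerset.image fun S => OrderDual.toDual (S.inf id)

/-- The whole space, the least element of the intersection lattice. -/
def wholeSpace (𝓐 : Finset (Submodule ℝ (E n))) : {X // X ∈ intersections 𝓐} :=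
  ⟨OrderDual.toDual ⊤, Finset.mem_image.2 ⟨∅, by simp, by simp⟩⟩

open Classical in
/-- Intervals in the (finite) intersection lattice are finite. -/
instance instLocallyFiniteIntersections (𝓐 : Finset (Submodule ℝ (E n))) :
    LocallyFiniteOrder {X // X ∈ intersections 𝓐} :=
  Fintype.toLocallyFiniteOrder

open Classical in
/-- The characteristic polynomial `∑ X, μ(X) t ^ dim X` of a finite central arrangement, the sum
running over the intersection lattice, and `μ(X) = μ(ℝⁿ, X)` being its Möbius function. -/
def charPoly (𝓐 : Finset (Submodule ℝ (E n))) : ℤ[X] :=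
  ∑ Y : {X // X ∈ intersections 𝓐},
    C (IncidenceAlgebra.mu ℤ (wholeSpace 𝓐) Y) *
      X ^ Module.finrank ℝ (OrderDual.ofDual Y.1 : Submodule ℝ (E n))

/-- The complement of the union of the hyperplanes of an arrangement. -/
def complement (𝓐 : Finset (Submodule ℝ (E n))) : Set (E n) :=
  {x | ∀ H ∈ 𝓐, x ∉ H}

/-- `K` is a closed chamber of `𝓐`: the closure of a connected component of the complement. -/
def IsClosedChamber (𝓐 : Finset (Submodule ℝ (E n))) (K : Set (E n)) : Prop :=
  ∃ p ∈ complement 𝓐, K = closure (connectedComponentIn (complement 𝓐) p)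

end Arrangement

section Projection

variable {n : ℕ}

/-- `p` is the orthogonal (nearest point) projection of `y` onto `K`. When `K` is non-empty, closed
and convex, there is exactly one such point. -/
def IsProjection (K : Set (E n)) (y p : E n) : Prop :=
  p ∈ K ∧ ∀ z ∈ K, dist y p ≤ dist y z

/-- `p` lies in the relative interior of a `k`-dimensional face of `K`, a face being the set of
maximizers on `K` of a linear functional (the zero functional gives `K` itself). -/
def InRelintOfFace (K : Set (E n)) (k : ℕ) (p : E n) : Prop :=
  ∃ F : Set (E n), IsExposed ℝ K F ∧ p ∈ intrinsicInterior ℝ F ∧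
    Module.finrank ℝ (vectorSpan ℝ F) = k

/-- The projection of `y` onto `K` is `k`-dimensional. -/
def HasProjectionDim (K : Set (E n)) (k : ℕ) (y : E n) : Prop :=
  ∃ p, IsProjection K y p ∧ InRelintOfFace K k p

end Projection

/-- The reflection group `D_n`: signed permutations of coordinates with an even number of sign
changes, as linear isometries of `ℝⁿ`. -/
def groupD (n : ℕ) : Subgroup (E n ≃ₗᵢ[ℝ] E n) where
  carrier := {g | ∃ (σ : Equiv.Perm (Fin n)) (ε : Fin n → ℤˣ), ∏ i, ε i = 1 ∧
    ∀ (x : E n) (i : Fin n), g x i = ((ε i : ℤ) : ℝ) * x (σ i)}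
  one_mem' := ⟨1, 1, by simp, by simp⟩
  mul_mem' := by
    rintro g h ⟨σ, ε, hε, hg⟩ ⟨τ, δ, hδ, hh⟩
    refine ⟨σ.trans τ, fun i => ε i * δ (σ i), ?_, fun x i => ?_⟩
    · rw [Finset.prod_mul_distrib, hε, Equiv.prod_comp σ δ, hδ, one_mul]
    · change g (h x) i = _
      rw [hg, hh]
      simp [mul_assoc]
  inv_mem' := by
    rintro g ⟨σ, ε, hε, hg⟩
    refine ⟨σ.symm, fun i => ε (σ.symm i), ?_, fun x i => ?_⟩
    · rw [Equiv.prod_comp σ.symm ε, hε]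
    · have h := hg (g⁻¹ x) (σ.symm i)
      have h1 : g (g⁻¹ x) = x := g.apply_symm_apply x
      rw [h1, Equiv.apply_symm_apply] at h
      rw [h, ← mul_assoc, ← Int.cast_mul, Int.units_coe_mul_self, Int.cast_one, one_mul]

/-- The hyperplane `x_i = x_j` (for `i ≠ j`). -/
def hyperplaneSub {n : ℕ} (i j : Fin n) : Submodule ℝ (E n) where
  carrier := {x | x i - x j = 0}
  zero_mem' := by simp
  add_mem' := by
    intro a b ha hb
    simp only [Set.mem_ofPred_eq, PiLp.add_apply] at *
    linarith
  smul_mem' := by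
    intro c a ha
    simp only [Set.mem_ofPred_eq, PiLp.smul_apply, smul_eq_mul] at *
    rw [← mul_sub, ha, mul_zero]

/-- The hyperplane `x_i = - x_j` (for `i ≠ j`). -/
def hyperplaneAdd {n : ℕ} (i j : Fin n) : Submodule ℝ (E n) where
  carrier := {x | x i + x j = 0}
  zero_mem' := by simp
  add_mem' := by
    intro a b ha hb
    simp only [Set.mem_ofPred_eq, PiLp.add_apply] at *
    linarith
  smul_mem' := by
    intro c a ha
    simp only [Set.mem_ofPred_eq, PiLp.smul_apply, smul_eq_mul] at *
    rw [← mul_add, ha, mul_zero]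

open Classical in
/-- The reflection arrangement of `D_n`: the hyperplanes `x_i = x_j` and `x_i = - x_j`
for `i < j`. -/
def arrangementD (n : ℕ) : Finset (Submodule ℝ (E n)) :=
  (Finset.univ.filter fun q : Fin n × Fin n => q.1 < q.2).image
      (fun q => hyperplaneSub q.1 q.2) ∪
    (Finset.univ.filter fun q : Fin n × Fin n => q.1 < q.2).image
      (fun q => hyperplaneAdd q.1 q.2)

end CoxeterD

end

/-! Every `g` in `D_n` is an isometry permuting the hyperplanes, so projecting `g x` to a chamber
`K` gives `g` applied to the projection of `x` to `g⁻¹ K`, on a face of the same dimension. As `D_n`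
acts simply transitively on chambers, the left side counts the chambers whose nearest point to `x`
is `k`-dimensional (`ncard_hasProjectionDim`). The rest of the count works for any finite central
arrangement of non-zero functionals and any generic `x`.

The span of the face of a chamber with `q` in its relative interior is the smallest flat through
`q`. Let `N(Y)` be the number of chambers for which the nearest point to `x` has smallest flat `Y`,
and fix a flat `L`. If the smallest flat contains `L`, then near the nearest point the chamber
coincides with the surrounding chamber of the localization at `L` (the hyperplanes containing `L`),
so both have the same nearest point. Conversely, genericity keeps the nearest point in a chamber of
the localization off all other hyperplanes, so it singles out one chamber of the full arrangement.
Hence the sum of `N(Y)` over `Y ⊇ L` is the number of chambers of the localization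
(`card_le_flatThrough_proj`). By Zaslavsky's formula (`sum_mobius_sign`), deduced from Euler's
relation (`sum_covectors`), this is `(-1)^n ∑ μ(Y) (-1)^(dim Y)` over the same `Y`. Induction over
flats gives `N(Y) = (-1)^n (-1)^(dim Y) μ(Y)` (`card_flatThrough_proj_eq`). On flats of dimension
`k` the sign is constant, so summing gives the absolute value of a coefficient.

For the factorization, a `d`-dimensional flat of `D_n` contains exactly `(2m+1)^d` points of the
grid `{-m, ..., m}^n`. Hence `χ(2m+1)` counts the grid points on no hyperplane
(`eval_charPoly_rootD`), that is, vectors with pairwise distinct absolute values, at most one of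
them zero. Counting these directly gives the product at all odd `2m+1`, which determines the
polynomial. -/

noncomputable section

namespace CoxeterD

open Classical

/-! ### Flats of an arrangement given by functionals, and the Möbius recursion. -/

section Flats

variable {n : ℕ}

/-- The Möbius function of the intersection lattice, from the whole space. -/
def mobius (𝓐 : Finset (Submodule ℝ (E n))) (Y : {X // X ∈ intersections 𝓐}) : ℤ :=
  IncidenceAlgebra.mu ℤ (wholeSpace 𝓐) Y

/-- The subspace underlying an element of the intersection lattice. -/
def flat {𝓐 : Finset (Submodule ℝ (E n))} (Y : {X // X ∈ intersections 𝓐}) :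
    Submodule ℝ (E n) := OrderDual.ofDual Y.1

theorem flat_le_flat {𝓐 : Finset (Submodule ℝ (E n))} {Y Z : {X // X ∈ intersections 𝓐}} :
    flat Y ≤ flat Z ↔ Z ≤ Y := Iff.rfl

theorem flat_injective {𝓐 : Finset (Submodule ℝ (E n))} :
    Function.Injective (flat (𝓐 := 𝓐)) := fun _ _ h => Subtype.ext h

theorem charPoly_eq (𝓐 : Finset (Submodule ℝ (E n))) :
    charPoly 𝓐 = ∑ Y : {X // X ∈ intersections 𝓐},
      C (mobius 𝓐 Y) * X ^ Module.finrank ℝ (flat Y) := rfl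

theorem wholeSpace_le {𝓐 : Finset (Submodule ℝ (E n))} (Z : {X // X ∈ intersections 𝓐}) :
    wholeSpace 𝓐 ≤ Z := flat_le_flat.1 (le_top (a := flat Z))

theorem wholeSpace_eq_iff {𝓐 : Finset (Submodule ℝ (E n))} (Z : {X // X ∈ intersections 𝓐}) :
    wholeSpace 𝓐 = Z ↔ flat Z = ⊤ :=
  ⟨fun h => h ▸ rfl, fun h => flat_injective (h.symm ▸ rfl)⟩

/-- In the reversed order the interval from the whole space to `Z` consists of the flats containing
`Z`, so this is the defining recursion of `μ`. -/
theorem sum_mobius {𝓐 : Finset (Submodule ℝ (E n))} (Z : {X // X ∈ intersections 𝓐}) :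
    ∑ Y with flat Z ≤ flat Y, mobius 𝓐 Y = if flat Z = ⊤ then 1 else 0 := by
  have h := IncidenceAlgebra.sum_Icc_mu_right (𝕜 := ℤ) (wholeSpace 𝓐) Z
  rw [if_congr (wholeSpace_eq_iff Z) rfl rfl] at h
  rw [← h]
  refine Finset.sum_congr ?_ fun _ _ => rfl
  ext Y
  simp [flat_le_flat, wholeSpace_le]

variable {ι : Type*} (a : ι → E n →L[ℝ] ℝ)

/-- The common zeros of the functionals indexed by `S`. -/
def zeroSpace (S : Finset ι) : Submodule ℝ (E n) where
  carrier := {x | ∀ i ∈ S, a i x = 0}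
  zero_mem' := by simp
  add_mem' := by
    intro x y hx hy i hi
    simp [hx i hi, hy i hi]
  smul_mem' := by
    intro c x hx i hi
    simp [hx i hi]

variable {a} in
theorem mem_zeroSpace {S : Finset ι} {x : E n} : x ∈ zeroSpace a S ↔ ∀ i ∈ S, a i x = 0 := Iff.rfl

variable [Fintype ι]

/-- The arrangement of the kernels of a family of functionals. -/
def kernels : Finset (Submodule ℝ (E n)) := Finset.univ.image fun i => (a i).ker

theorem exists_flat_eq (S : Finset ι) :
    ∃ Y : {X // X ∈ intersections (kernels a)}, flat Y = zeroSpace a S := by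
  have h : (S.image fun i => (a i).ker).inf id = zeroSpace a S := by
    ext x
    simp [mem_zeroSpace, Submodule.mem_finsetInf]
  exact ⟨⟨OrderDual.toDual ((S.image fun i => (a i).ker).inf id), Finset.mem_image.2
    ⟨_, Finset.mem_powerset.2 (Finset.image_subset_image (Finset.subset_univ S)), rfl⟩⟩, h⟩

theorem exists_eq_zeroSpace (Y : {X // X ∈ intersections (kernels a)}) :
    ∃ S : Finset ι, flat Y = zeroSpace a S := by
  obtain ⟨Y, hY⟩ := Y
  obtain ⟨T, hT, rfl⟩ := Finset.mem_image.1 hY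
  refine ⟨Finset.univ.filter fun i => (a i).ker ∈ T, ?_⟩
  ext x
  simp only [flat, OrderDual.ofDual_toDual, Submodule.mem_finsetInf, id, mem_zeroSpace,
    Finset.mem_filter, Finset.mem_univ, true_and]
  refine ⟨fun h i hi => h _ hi, fun h H hH => ?_⟩
  obtain ⟨i, -, rfl⟩ := Finset.mem_image.1 (Finset.mem_powerset.1 hT hH)
  exact h i hH

/-- The indices of the functionals that vanish on `L`. -/
def vanishing (L : Submodule ℝ (E n)) : Finset ι := Finset.univ.filter fun i => L ≤ (a i).ker

variable {a}

theorem mem_vanishing {L : Submodule ℝ (E n)} {i : ι} : i ∈ vanishing a L ↔ ∀ x ∈ L, a i x = 0 := by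
  simp [vanishing, SetLike.le_def]

theorem zeroSpace_vanishing_flat (Y : {X // X ∈ intersections (kernels a)}) :
    zeroSpace a (vanishing a (flat Y)) = flat Y := by
  obtain ⟨S, hS⟩ := exists_eq_zeroSpace a Y
  refine le_antisymm (fun x hx => ?_) fun x hx i hi => mem_vanishing.1 hi x hx
  rw [hS]
  exact fun i hi => hx i (mem_vanishing.2 fun y hy => (hS ▸ hy : y ∈ zeroSpace a S) i hi)

theorem le_zeroSpace_iff {L : Submodule ℝ (E n)} {S : Finset ι} :
    L ≤ zeroSpace a S ↔ S ⊆ vanishing a L := by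
  refine ⟨fun h i hi => mem_vanishing.2 fun x hx => h hx i hi, fun h x hx i hi =>
    mem_vanishing.1 (h hi) x hx⟩

end Flats

/-! ### Sign vectors and their behaviour along segments and small displacements. -/

section SignVectors

variable {n : ℕ} {ι : Type*} (a : ι → E n →L[ℝ] ℝ)

/-- The signs of the functionals in `J` at a point, extended by zero. -/
def signOn (J : Finset ι) (p : E n) (i : ι) : SignType :=
  if i ∈ J then SignType.sign (a i p) else 0

/-- The indices in `J` at which a sign vector vanishes. -/
def zerosOn (J : Finset ι) (s : ι → SignType) : Finset ι := J.filter fun i => s i = 0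

variable {a}

theorem mem_zerosOn_signOn {J : Finset ι} {p : E n} {i : ι} :
    i ∈ zerosOn J (signOn a J p) ↔ i ∈ J ∧ a i p = 0 := by
  simp +contextual [zerosOn, signOn]

theorem signOn_insert {J : Finset ι} {j : ι} (p : E n) :
    signOn a (insert j J) p = Function.update (signOn a J p) j (SignType.sign (a j p)) := by
  ext i
  rcases eq_or_ne i j with rfl | h
  · simp [signOn]
  · simp [signOn, h]

/-- Signs are preserved along segments between points with the same signs, and a functional which
changes sign has a zero in between. -/
theorem exists_signOn_eq_zero {J : Finset ι} {M : Submodule ℝ (E n)} {p q : E n} {j : ι}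
    (hp : p ∈ M) (hq : q ∈ M) (h : signOn a J p = signOn a J q) (h1 : 0 < a j p) (h2 : a j q < 0) :
    ∃ r ∈ M, signOn a J r = signOn a J p ∧ a j r = 0 := by
  -- The positive weights are chosen to make `a j` cancel. They need not sum to one, because signs
  -- are unchanged by positive scaling.
  refine ⟨(-a j q) • p + (a j p) • q, M.add_mem (M.smul_mem _ hp) (M.smul_mem _ hq), ?_, ?_⟩
  · ext i
    have hi := congrFun h i
    by_cases hJ : i ∈ J
    · simp only [signOn, hJ, if_true] at hi ⊢
      simp only [map_add, map_smul, smul_eq_mul]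
      rcases lt_trichotomy (a i p) 0 with h0 | h0 | h0
      · rw [sign_neg h0] at hi ⊢
        have := sign_eq_neg_one_iff.1 hi.symm
        exact sign_neg (by nlinarith)
      · rw [h0, sign_zero] at hi ⊢
        have := sign_eq_zero_iff.1 hi.symm
        simp [this]
      · rw [sign_pos h0] at hi ⊢
        have := sign_eq_one_iff.1 hi.symm
        exact sign_pos (by nlinarith)
    · simp [signOn, hJ]
  · simp; ring

theorem sign_add_small (u v : ℝ) (hu : u ≠ 0) :
    ∃ δ > 0, ∀ ε, |ε| < δ → SignType.sign (u + ε * v) = SignType.sign u := by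
  have h : Filter.Tendsto (fun ε : ℝ => u + ε * v) (nhds 0) (nhds u) := by
    have : Continuous fun ε : ℝ => u + ε * v := by fun_prop
    simpa using this.tendsto 0
  have h2 : ∀ᶠ ε in nhds (0 : ℝ), SignType.sign (u + ε * v) = SignType.sign u := by
    rcases lt_or_gt_of_ne hu with h0 | h0
    · filter_upwards [h.eventually (gt_mem_nhds h0)] with ε hε
      rw [sign_neg hε, sign_neg h0]
    · filter_upwards [h.eventually (lt_mem_nhds h0)] with ε hε
      rw [sign_pos hε, sign_pos h0]
  obtain ⟨δ, hδ, h3⟩ := Metric.eventually_nhds_iff.1 h2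
  exact ⟨δ, hδ, fun ε hε => h3 (by simpa using hε)⟩

theorem finrank_inf_ker (Z : Submodule ℝ (E n)) (f : E n →L[ℝ] ℝ) (h : ¬ Z ≤ f.ker) :
    Module.finrank ℝ (Z ⊓ f.ker : Submodule ℝ (E n)) + 1 = Module.finrank ℝ Z := by
  obtain ⟨v, hv, hv0⟩ := SetLike.not_le_iff_exists.1 h
  let g : Z →ₗ[ℝ] ℝ := f.toLinearMap.comp Z.subtype
  have hg : g ≠ 0 := fun h0 => hv0 (LinearMap.congr_fun h0 ⟨v, hv⟩)
  have h1 := g.finrank_range_add_finrank_ker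
  rw [LinearMap.range_eq_top.2 (LinearMap.surjective hg), finrank_top, Module.finrank_self] at h1
  have h2 : (Z ⊓ f.ker : Submodule ℝ (E n)) = g.ker.map Z.subtype := by
    ext x
    simp only [Submodule.mem_inf, Submodule.mem_map]
    constructor
    · rintro ⟨hx, hx0⟩
      exact ⟨⟨x, hx⟩, hx0, rfl⟩
    · rintro ⟨y, hy, rfl⟩
      exact ⟨y.2, hy⟩
  rw [h2, LinearEquiv.finrank_eq (Submodule.equivMapOfInjective _ Z.injective_subtype _).symm]
  omega

variable (a) [Fintype ι]

/-- The sign vectors of the functionals in `J` at points of `M`. -/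
def covectors (J : Finset ι) (M : Submodule ℝ (E n)) : Finset (ι → SignType) :=
  Finset.univ.filter fun s => ∃ p ∈ M, signOn a J p = s

variable {a}

theorem mem_covectors {J : Finset ι} {M : Submodule ℝ (E n)} {s : ι → SignType} :
    s ∈ covectors a J M ↔ ∃ p ∈ M, signOn a J p = s := by
  simp [covectors]

/-- Moving a little from `p` does not change the signs that are non-zero at `p`. -/
theorem exists_signs_stable (p v : E n) :
    ∃ ε > 0, ∀ c : ℝ, |c| ≤ ε → ∀ i : ι, a i p ≠ 0 →
      SignType.sign (a i (p + c • v)) = SignType.sign (a i p) := by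
  have h : ∀ i : ι, ∀ᶠ c in nhds (0 : ℝ), a i p ≠ 0 →
      SignType.sign (a i (p + c • v)) = SignType.sign (a i p) := by
    intro i
    by_cases hi : a i p = 0
    · simp [hi]
    · obtain ⟨δ, hδ, h⟩ := sign_add_small (a i p) (a i v) hi
      refine Metric.eventually_nhds_iff.2 ⟨δ, hδ, fun c hc _ => ?_⟩
      simpa using h c (by simpa using hc)
  obtain ⟨δ, hδ, h3⟩ := Metric.eventually_nhds_iff.1 (Filter.eventually_all.2 h)
  exact ⟨δ / 2, by positivity, fun c hc i => h3 (by
    rw [Real.dist_eq, sub_zero]; linarith) i⟩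

/-- Faces are relatively open in their span: directions in the zero space keep the zeros, and small
steps keep the other signs. -/
theorem signOn_add_smul {J : Finset ι} {M : Submodule ℝ (E n)} {p v : E n}
    (hv : v ∈ M ⊓ zeroSpace a (zerosOn J (signOn a J p))) :
    ∃ ε > 0, ∀ c : ℝ, |c| ≤ ε → signOn a J (p + c • v) = signOn a J p := by
  obtain ⟨ε, hε, h⟩ := exists_signs_stable (a := a) p v
  refine ⟨ε, hε, fun c hc => ?_⟩
  ext i
  by_cases hi : i ∈ J
  · by_cases h0 : a i p = 0
    · have := hv.2 i (mem_zerosOn_signOn.2 ⟨hi, h0⟩)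
      simp [signOn, h0, this]
    · simp only [signOn, hi, if_true]
      rw [h c hc i h0]
  · simp [signOn, hi]

end SignVectors

/-! ### Euler's relation and Zaslavsky's theorem for localizations. -/

section Euler

variable {n : ℕ} {ι : Type*} [Fintype ι] {a : ι → E n →L[ℝ] ℝ}

/-- The hyperplane of `a j` either contains a face of dimension `d`, misses it, or cuts it into two
pieces of dimension `d` and one of dimension `d - 1`. The alternating sum is preserved because
`(-1)^d + (-1)^d + (-1)^(d-1) = (-1)^d`. -/
theorem sum_signs_one_step {J : Finset ι} {M : Submodule ℝ (E n)} {s : ι → SignType} (j : ι)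
    (hs : ∃ p ∈ M, signOn a J p = s) :
    ∑ σ : SignType with ∃ p ∈ M, signOn a J p = s ∧ SignType.sign (a j p) = σ,
      (-1 : ℤ) ^ Module.finrank ℝ (if σ = 0 then M ⊓ zeroSpace a (zerosOn J s) ⊓ (a j).ker
        else M ⊓ zeroSpace a (zerosOn J s) : Submodule ℝ (E n)) =
      (-1) ^ Module.finrank ℝ (M ⊓ zeroSpace a (zerosOn J s) : Submodule ℝ (E n)) := by
  have hmem : ∀ p ∈ M, signOn a J p = s → p ∈ M ⊓ zeroSpace a (zerosOn J s) := by
    rintro p hp rfl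
    exact ⟨hp, fun i hi => (mem_zerosOn_signOn.1 hi).2⟩
  have hex : (∃ p ∈ M, signOn a J p = s ∧ SignType.sign (a j p) = 0) ∨
      (∃ p ∈ M, signOn a J p = s ∧ SignType.sign (a j p) = -1) ∨
      ∃ p ∈ M, signOn a J p = s ∧ SignType.sign (a j p) = 1 := by
    obtain ⟨p, hp, h⟩ := hs
    rcases h0 : SignType.sign (a j p)
    exacts [.inl ⟨p, hp, h, h0⟩, .inr (.inl ⟨p, hp, h, h0⟩), .inr (.inr ⟨p, hp, h, h0⟩)]
  have huniv : (Finset.univ : Finset SignType) = {0, -1, 1} := rfl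
  rw [Finset.sum_filter, huniv, Finset.sum_insert (by decide), Finset.sum_insert (by decide),
    Finset.sum_singleton]
  set Z := M ⊓ zeroSpace a (zerosOn J s) with hZ
  by_cases hker : Z ≤ (a j).ker
  · have h0 : ∀ p ∈ M, signOn a J p = s → SignType.sign (a j p) = 0 := fun p hp h =>
      sign_eq_zero_iff.2 (hker (hmem p hp h))
    have h1 : ¬ ∃ p ∈ M, signOn a J p = s ∧ SignType.sign (a j p) = 1 := by
      rintro ⟨p, hp, h, h1⟩
      rw [h0 p hp h] at h1
      exact absurd h1 (by decide)
    have h2 : ¬ ∃ p ∈ M, signOn a J p = s ∧ SignType.sign (a j p) = -1 := by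
      rintro ⟨p, hp, h, h1⟩
      rw [h0 p hp h] at h1
      exact absurd h1 (by decide)
    have h3 : ∃ p ∈ M, signOn a J p = s ∧ SignType.sign (a j p) = 0 := by
      simpa only [h1, h2, or_false] using hex
    rw [if_pos h3, if_neg h1, if_neg h2, if_pos rfl, inf_eq_left.2 hker]
    simp
  · have hr := finrank_inf_ker Z (a j) hker
    obtain ⟨v, hv, hv0⟩ := SetLike.not_le_iff_exists.1 hker
    have hv0 : a j v ≠ 0 := hv0
    have hmove : (∃ p ∈ M, signOn a J p = s ∧ SignType.sign (a j p) = 0) →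
        (∃ p ∈ M, signOn a J p = s ∧ SignType.sign (a j p) = 1) ∧
        ∃ p ∈ M, signOn a J p = s ∧ SignType.sign (a j p) = -1 := by
      rintro ⟨p, hp, h, hp0⟩
      -- The direction is scaled so that `a j` increases at unit rate along it; the two ends of a
      -- short segment then have opposite signs.
      have hw : (a j v)⁻¹ • v ∈ M ⊓ zeroSpace a (zerosOn J (signOn a J p)) := by
        rw [h]; exact Z.smul_mem _ hv
      obtain ⟨ε, hε, hc⟩ := signOn_add_smul hw
      have hval : ∀ c : ℝ, a j (p + c • (a j v)⁻¹ • v) = c := by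
        intro c
        simp [sign_eq_zero_iff.1 hp0, hv0]
      refine ⟨⟨_, M.add_mem hp (M.smul_mem ε hw.1), (hc ε ?_).trans h, ?_⟩,
        ⟨_, M.add_mem hp (M.smul_mem (-ε) hw.1), (hc (-ε) ?_).trans h, ?_⟩⟩
      · rw [abs_of_pos hε]
      · rw [hval, sign_pos hε]
      · rw [abs_neg, abs_of_pos hε]
      · rw [hval, sign_neg (by linarith)]
    have hback : (∃ p ∈ M, signOn a J p = s ∧ SignType.sign (a j p) = 1) →
        (∃ p ∈ M, signOn a J p = s ∧ SignType.sign (a j p) = -1) →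
        ∃ p ∈ M, signOn a J p = s ∧ SignType.sign (a j p) = 0 := by
      rintro ⟨p, hp, h, hp0⟩ ⟨q, hq, h', hq0⟩
      obtain ⟨r, hr, h1, h2⟩ := exists_signOn_eq_zero hp hq (h.trans h'.symm)
        (sign_eq_one_iff.1 hp0) (sign_eq_neg_one_iff.1 hq0)
      exact ⟨r, hr, h1.trans h, sign_eq_zero_iff.2 h2⟩
    rw [if_neg (by decide : (-1 : SignType) ≠ 0), if_neg (by decide : (1 : SignType) ≠ 0),
      if_pos rfl, ← hr]
    by_cases c0 : ∃ p ∈ M, signOn a J p = s ∧ SignType.sign (a j p) = 0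
    · rw [if_pos c0, if_pos (hmove c0).1, if_pos (hmove c0).2]
      ring
    · rw [if_neg c0]
      by_cases c1 : ∃ p ∈ M, signOn a J p = s ∧ SignType.sign (a j p) = 1
      · rw [if_pos c1, if_neg fun h => c0 (hback c1 h)]
        simp
      · have c2 : ∃ p ∈ M, signOn a J p = s ∧ SignType.sign (a j p) = -1 := by
          simpa only [c0, c1, false_or, or_false] using hex
        rw [if_neg c1, if_pos c2]
        simp

/-- Euler's relation for the faces of a central arrangement in the subspace `M`. -/
theorem sum_covectors (J : Finset ι) (M : Submodule ℝ (E n)) :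
    ∑ s ∈ covectors a J M,
      (-1 : ℤ) ^ Module.finrank ℝ (M ⊓ zeroSpace a (zerosOn J s) : Submodule ℝ (E n)) =
      (-1) ^ Module.finrank ℝ M := by
  induction J using Finset.induction_on with
  | empty =>
    have h : covectors a ∅ M = {0} := by
      ext s
      rw [mem_covectors, Finset.mem_singleton]
      constructor
      · rintro ⟨p, -, rfl⟩
        ext i
        simp [signOn]
      · rintro rfl
        exact ⟨0, M.zero_mem, by ext i; simp [signOn]⟩
    have h2 : M ⊓ zeroSpace a (zerosOn ∅ 0) = M := inf_eq_left.2 fun x _ i hi => by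
      simp [zerosOn] at hi
    rw [h, Finset.sum_singleton, h2]
  | insert j J hj ih =>
    have h0 : ∀ p, signOn a J p j = 0 := fun p => by simp [signOn, hj]
    have hmaps : ∀ t ∈ covectors a (insert j J) M, Function.update t j 0 ∈ covectors a J M := by
      intro t ht
      obtain ⟨p, hp, rfl⟩ := mem_covectors.1 ht
      refine mem_covectors.2 ⟨p, hp, ?_⟩
      rw [signOn_insert, Function.update_idem, eq_comm, Function.update_eq_self_iff, h0]
    rw [← Finset.sum_fiberwise_of_maps_to hmaps, ← ih]
    refine Finset.sum_congr rfl fun s hs => ?_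
    have hs' := mem_covectors.1 hs
    have hsj : s j = 0 := by
      obtain ⟨p, -, rfl⟩ := hs'
      exact h0 p
    -- Forgetting the sign at `j` fibres the new faces over the old ones; a fibre records the signs
    -- that `a j` takes on the old face.
    have hfib : (covectors a (insert j J) M).filter (fun t => Function.update t j 0 = s) =
        (Finset.univ.filter fun σ : SignType =>
          ∃ p ∈ M, signOn a J p = s ∧ SignType.sign (a j p) = σ).image
            fun σ => Function.update s j σ := by
      ext t
      simp only [Finset.mem_filter, mem_covectors, Finset.mem_image, Finset.mem_univ, true_and]
      constructor
      · rintro ⟨⟨p, hp, rfl⟩, h⟩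
        rw [signOn_insert, Function.update_idem, Function.update_eq_self_iff.2 (h0 p).symm] at h
        exact ⟨_, ⟨p, hp, h, rfl⟩, by rw [signOn_insert, h]⟩
      · rintro ⟨σ, ⟨p, hp, h, rfl⟩, rfl⟩
        refine ⟨⟨p, hp, by rw [signOn_insert, h]⟩, ?_⟩
        rw [Function.update_idem, Function.update_eq_self_iff, hsj]
    rw [hfib, Finset.sum_image fun σ _ τ _ h => Function.update_injective s j h,
      ← sum_signs_one_step j hs']
    refine Finset.sum_congr rfl fun σ _ => ?_
    have hz : ∀ i ∈ J, Function.update s j σ i = s i := fun i hi =>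
      Function.update_of_ne (ne_of_mem_of_not_mem hi hj) _ _
    refine congrArg (fun N : Submodule ℝ (E n) => (-1 : ℤ) ^ Module.finrank ℝ N) ?_
    split_ifs with h
    · ext x
      subst h
      simp only [Submodule.mem_inf, mem_zeroSpace, zerosOn, Finset.mem_filter,
        Finset.mem_insert]
      constructor
      · rintro ⟨hx, h⟩
        exact ⟨⟨hx, fun i hi => h i ⟨.inr hi.1, (hz i hi.1).trans hi.2⟩⟩,
          h j ⟨.inl rfl, Function.update_self ..⟩⟩
      · rintro ⟨⟨hx, h⟩, hxj⟩
        refine ⟨hx, ?_⟩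
        rintro i ⟨rfl | hi, h'⟩
        · exact hxj
        · exact h i ⟨hi, (hz i hi) ▸ h'⟩
    · ext x
      simp only [Submodule.mem_inf, mem_zeroSpace, zerosOn, Finset.mem_filter,
        Finset.mem_insert]
      refine and_congr_right fun _ => ⟨fun h' i hi => h' i ⟨.inr hi.1, (hz i hi.1).trans hi.2⟩, ?_⟩
      rintro h' i ⟨rfl | hi, h0⟩
      · rw [Function.update_self] at h0
        exact absurd h0 h
      · exact h' i ⟨hi, (hz i hi) ▸ h0⟩

/-- The sign vectors of the chambers of the arrangement of the functionals in `J`. -/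
def chambers (a : ι → E n →L[ℝ] ℝ) (J : Finset ι) : Finset (ι → SignType) :=
  (covectors a J ⊤).filter fun s => ∀ i ∈ J, s i ≠ 0

/-- Zaslavsky's theorem for the localization of an arrangement at a flat. -/
theorem sum_mobius_sign (ha : ∀ i, a i ≠ 0) (L : {X // X ∈ intersections (kernels a)}) :
    ∑ Y with flat L ≤ flat Y, mobius (kernels a) Y * (-1) ^ Module.finrank ℝ (flat Y) =
      (-1) ^ n * ((chambers a (vanishing a (flat L))).card : ℤ) := by
  set J := vanishing a (flat L) with hJ
  have hzs : ∀ p, p ∈ zeroSpace a (zerosOn J (signOn a J p)) := fun p i hi =>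
    (mem_zerosOn_signOn.1 hi).2
  have hle : ∀ {Y : {X // X ∈ intersections (kernels a)}}, flat L ≤ flat Y → ∀ p,
      (p ∈ flat Y ↔ zeroSpace a (zerosOn J (signOn a J p)) ≤ flat Y) := by
    intro Y hY p
    refine ⟨fun hp => ?_, fun h => h (hzs p)⟩
    rw [← zeroSpace_vanishing_flat Y]
    intro x hx i hi
    refine hx i (mem_zerosOn_signOn.2 ⟨?_, mem_vanishing.1 hi p hp⟩)
    exact mem_vanishing.2 fun y hy => mem_vanishing.1 hi y (hY hy)
  have hLle : ∀ s, flat L ≤ zeroSpace a (zerosOn J s) := fun s =>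
    le_zeroSpace_iff.2 (Finset.filter_subset _ _)
  -- Euler's relation inside `Y`: the faces of the localization meeting `Y` are those whose span
  -- lies in `Y`.
  have h1 : ∀ Y ∈ Finset.univ.filter (fun Y => flat L ≤ flat Y),
      mobius (kernels a) Y * (-1) ^ Module.finrank ℝ (flat Y) =
      ∑ s ∈ covectors a J ⊤, if zeroSpace a (zerosOn J s) ≤ flat Y then
        mobius (kernels a) Y * (-1) ^ Module.finrank ℝ (zeroSpace a (zerosOn J s)) else 0 := by
    intro Y hY
    have hY : flat L ≤ flat Y := by simpa using hY
    rw [← sum_covectors J (flat Y) (a := a), Finset.mul_sum, ← Finset.sum_filter]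
    refine Finset.sum_congr ?_ ?_
    · ext s
      simp only [mem_covectors, Finset.mem_filter, Submodule.mem_top, true_and]
      constructor
      · rintro ⟨p, hp, rfl⟩
        exact ⟨⟨p, rfl⟩, (hle hY p).1 hp⟩
      · rintro ⟨⟨p, rfl⟩, h⟩
        exact ⟨p, (hle hY p).2 h, rfl⟩
    · intro s hs
      obtain ⟨p, hp, rfl⟩ := mem_covectors.1 (Finset.mem_filter.1 hs).1
      rw [inf_eq_right.2 ((hle hY p).1 ((hle hY p).2 (Finset.mem_filter.1 hs).2))]
  rw [Finset.sum_congr rfl h1, Finset.sum_comm]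
  -- After exchanging the sums, a face contributes the sum of `μ` over the flats containing its
  -- span. By the Möbius recursion only faces spanning the whole space, the chambers, survive.
  have h2 : ∀ s ∈ covectors a J ⊤,
      (∑ Y with flat L ≤ flat Y, if zeroSpace a (zerosOn J s) ≤ flat Y then
        mobius (kernels a) Y * (-1) ^ Module.finrank ℝ (zeroSpace a (zerosOn J s)) else 0) =
      if ∀ i ∈ J, s i ≠ 0 then (-1) ^ n else 0 := by
    intro s hs
    obtain ⟨Z, hZ⟩ := exists_flat_eq a (zerosOn J s)
    rw [← Finset.sum_filter, Finset.filter_filter, ← Finset.sum_mul]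
    have h3 : (Finset.univ.filter fun Y : {X // X ∈ intersections (kernels a)} =>
        flat L ≤ flat Y ∧ zeroSpace a (zerosOn J s) ≤ flat Y) =
        Finset.univ.filter fun Y => flat Z ≤ flat Y := by
      ext Y
      simp only [Finset.mem_filter, Finset.mem_univ, true_and, hZ]
      exact ⟨fun h => h.2, fun h => ⟨(hLle s).trans h, h⟩⟩
    rw [h3, sum_mobius]
    have h4 : flat Z = ⊤ ↔ ∀ i ∈ J, s i ≠ 0 := by
      rw [hZ]
      constructor
      · intro h i hi h0
        refine ha i (ContinuousLinearMap.ext fun x => ?_)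
        have hx : x ∈ zeroSpace a (zerosOn J s) := h ▸ Submodule.mem_top
        exact hx i (Finset.mem_filter.2 ⟨hi, h0⟩)
      · intro h
        rw [eq_top_iff]
        intro x _ i hi
        exact absurd (Finset.mem_filter.1 hi).2 (h i (Finset.mem_filter.1 hi).1)
    by_cases h5 : ∀ i ∈ J, s i ≠ 0
    · rw [if_pos (h4.2 h5), if_pos h5, ← hZ, h4.2 h5, finrank_top, finrank_euclideanSpace_fin,
        one_mul]
    · rw [if_neg fun h => h5 (h4.1 h), if_neg h5, zero_mul]
  rw [Finset.sum_congr rfl h2, ← Finset.sum_filter, Finset.sum_const, chambers]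
  simp [mul_comm]

end Euler

/-! ### Closed chambers as polyhedral cones, their faces, and nearest points. -/

section Cones

variable {n : ℕ} {ι : Type*} (a : ι → E n →L[ℝ] ℝ)

/-- The closed cone on which each functional is zero or has the prescribed sign; there is no
condition where the prescribed sign is zero. -/
def cone (s : ι → SignType) : Set (E n) := {z | ∀ i, 0 ≤ (s i : ℝ) * a i z}

variable {a}

theorem convex_cone (s : ι → SignType) : Convex ℝ (cone a s) := by
  intro x hx y hy u v hu hv _ i
  have h1 := mul_nonneg hu (hx i)
  have h2 := mul_nonneg hv (hy i)
  simp only [map_add, map_smul, smul_eq_mul]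
  linarith

theorem isClosed_cone (s : ι → SignType) : IsClosed (cone a s) := by
  have : cone a s = ⋂ i, {z | 0 ≤ (s i : ℝ) * a i z} := by
    ext; simp [cone]
  rw [this]
  exact isClosed_iInter fun i => isClosed_le continuous_const (by fun_prop)

theorem zero_mem_cone (s : ι → SignType) : (0 : E n) ∈ cone a s := fun i => by simp

theorem cast_sign_ne_zero {σ : SignType} (h : σ ≠ 0) : (σ : ℝ) ≠ 0 := by
  rcases σ <;> simp_all

theorem sign_mul_nonneg_iff_of_sign_eq {σ : SignType} {u v : ℝ}
    (h : SignType.sign u = SignType.sign v) : 0 ≤ (σ : ℝ) * u ↔ 0 ≤ (σ : ℝ) * v := by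
  rw [← sign_nonneg_iff, ← sign_nonneg_iff (a := (σ : ℝ) * v), sign_mul, sign_mul, h]

theorem sign_mul_self_nonneg (u : ℝ) : 0 ≤ (SignType.sign u : ℝ) * u := by
  rw [sign_mul_self]; exact abs_nonneg u

theorem isProjection_iff {K : Set (E n)} (hK : Convex ℝ K) {y q : E n} :
    IsProjection K y q ↔ q ∈ K ∧ ∀ z ∈ K, inner ℝ (y - q) (z - q) ≤ 0 := by
  refine and_congr_right fun hq => ?_
  rw [← norm_eq_iInf_iff_real_inner_le_zero hK hq]
  have : Nonempty K := ⟨⟨q, hq⟩⟩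
  have hb : BddBelow (Set.range fun w : K => ‖y - w‖) :=
    ⟨0, Set.forall_mem_range.2 fun _ => norm_nonneg _⟩
  simp only [dist_eq_norm]
  constructor
  · intro h
    exact le_antisymm (le_ciInf fun w => h w w.2) (ciInf_le hb ⟨q, hq⟩)
  · intro h z hz
    rw [h]
    exact ciInf_le hb ⟨z, hz⟩

theorem IsProjection.unique {K : Set (E n)} (hK : Convex ℝ K) {y q r : E n}
    (hq : IsProjection K y q) (hr : IsProjection K y r) : q = r := by
  rw [isProjection_iff hK] at hq hr
  have h1 := hq.2 r hr.1
  have h2 := hr.2 q hq.1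
  have h3 : inner ℝ (q - r) (q - r) ≤ 0 := by
    have : inner ℝ (q - r) (q - r) = inner ℝ (y - q) (r - q) + inner ℝ (y - r) (q - r) := by
      rw [← neg_sub q r, inner_neg_right, ← sub_eq_neg_add, ← inner_sub_left]
      congr 1
      abel
    linarith
  exact sub_eq_zero.1 (inner_self_eq_zero.1 (le_antisymm h3 real_inner_self_nonneg))

theorem exists_isProjection_cone (s : ι → SignType) (y : E n) :
    ∃ q, IsProjection (cone a s) y q := by
  obtain ⟨q, hq, h⟩ := exists_norm_eq_iInf_of_complete_convex ⟨0, zero_mem_cone s⟩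
    (isClosed_cone (a := a) s).isComplete (convex_cone s) y
  exact ⟨q, (isProjection_iff (convex_cone s)).2
    ⟨hq, (norm_eq_iInf_iff_real_inner_le_zero (convex_cone s) hq).1 h⟩⟩

variable [Fintype ι]

theorem mem_complement_kernels {p : E n} : p ∈ complement (kernels a) ↔ ∀ i, a i p ≠ 0 := by
  simp [complement, kernels]

/-- By the intermediate value theorem no functional changes sign on the component; conversely, the
set of points with the signs of `p` is convex. -/
theorem connectedComponentIn_complement {p : E n} (hp : ∀ i, a i p ≠ 0) :
    connectedComponentIn (complement (kernels a)) p =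
      {z | ∀ i, SignType.sign (a i z) = SignType.sign (a i p)} := by
  apply Set.Subset.antisymm
  · intro z hz i
    have hpre : IsPreconnected (connectedComponentIn (complement (kernels a)) p) :=
      isPreconnected_connectedComponentIn
    have hp' : p ∈ connectedComponentIn (complement (kernels a)) p :=
      mem_connectedComponentIn (mem_complement_kernels.2 hp)
    have hne : ∀ w ∈ connectedComponentIn (complement (kernels a)) p, a i w ≠ 0 := fun w hw =>
      mem_complement_kernels.1 (connectedComponentIn_subset _ _ hw) i
    have hc : ContinuousOn (a i) (connectedComponentIn (complement (kernels a)) p) :=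
      (a i).continuous.continuousOn
    rcases lt_or_gt_of_ne (hp i) with h1 | h1 <;> rcases lt_or_gt_of_ne (hne z hz) with h2 | h2
    · rw [sign_neg h1, sign_neg h2]
    · obtain ⟨w, hw, h0⟩ := hpre.intermediate_value hp' hz hc ⟨h1.le, h2.le⟩
      exact absurd h0 (hne w hw)
    · obtain ⟨w, hw, h0⟩ := hpre.intermediate_value hz hp' hc ⟨h2.le, h1.le⟩
      exact absurd h0 (hne w hw)
    · rw [sign_pos h1, sign_pos h2]
  · refine IsPreconnected.subset_connectedComponentIn (Convex.isPreconnected ?_)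
      (fun i => rfl) ?_
    · intro x hx y hy u v hu hv huv i
      have hx := hx i
      have hy := hy i
      simp only [map_add, map_smul, smul_eq_mul]
      rcases hu.eq_or_lt with rfl | hu
      · rw [zero_add] at huv
        simpa [huv] using hy
      rcases lt_or_gt_of_ne (hp i) with h1 | h1
      · rw [sign_neg h1] at hx hy ⊢
        have hx := sign_eq_neg_one_iff.1 hx
        have hy := sign_eq_neg_one_iff.1 hy
        exact sign_neg (by nlinarith)
      · rw [sign_pos h1] at hx hy ⊢
        have hx := sign_eq_one_iff.1 hx
        have hy := sign_eq_one_iff.1 hy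
        exact sign_pos (by nlinarith)
    · intro z hz
      refine mem_complement_kernels.2 fun i h0 => ?_
      have := hz i
      rw [h0, sign_zero, eq_comm, sign_eq_zero_iff] at this
      exact hp i this

theorem signOn_univ (p : E n) (i : ι) : signOn a Finset.univ p i = SignType.sign (a i p) := by
  simp [signOn]

/-- A point `z` of the cone is the limit of `z + t • p` as `t` decreases to zero, and these points
have the strict signs of `p`. -/
theorem closure_signs {p : E n} (hp : ∀ i, a i p ≠ 0) :
    closure {z | ∀ i, SignType.sign (a i z) = SignType.sign (a i p)} =
      cone a (signOn a Finset.univ p) := by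
  apply Set.Subset.antisymm
  · refine closure_minimal (fun z hz i => ?_) (isClosed_cone _)
    rw [signOn_univ, ← hz i]
    exact sign_mul_self_nonneg _
  · intro z hz
    have hlim : Filter.Tendsto (fun t : ℝ => z + t • p) (nhdsWithin 0 (Set.Ioi 0)) (nhds z) := by
      have : Continuous fun t : ℝ => z + t • p := by fun_prop
      have := (this.tendsto 0).mono_left (nhdsWithin_le_nhds (s := Set.Ioi 0))
      simpa using this
    refine mem_closure_of_tendsto hlim ?_
    filter_upwards [self_mem_nhdsWithin] with t ht i
    have ht : 0 < t := ht
    have hi := hz i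
    rw [signOn_univ] at hi
    simp only [map_add, map_smul, smul_eq_mul]
    rcases lt_or_gt_of_ne (hp i) with h | h
    · rw [sign_neg h] at hi ⊢
      simp at hi
      exact sign_neg (by nlinarith)
    · rw [sign_pos h] at hi ⊢
      simp at hi
      exact sign_pos (by nlinarith)

theorem IsClosedChamber.exists_eq_cone {K : Set (E n)} (hK : IsClosedChamber (kernels a) K) :
    ∃ s ∈ chambers a Finset.univ, K = cone a s := by
  obtain ⟨p, hp, rfl⟩ := hK
  have hp := mem_complement_kernels.1 hp
  refine ⟨signOn a Finset.univ p, Finset.mem_filter.2 ⟨mem_covectors.2 ⟨p, trivial, rfl⟩,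
    fun i _ => ?_⟩, ?_⟩
  · rw [signOn_univ]
    exact sign_ne_zero.2 (hp i)
  · rw [connectedComponentIn_complement hp, closure_signs hp]

/-- The functionals vanishing at a point. -/
def zeroSet (a : ι → E n →L[ℝ] ℝ) (q : E n) : Finset ι := Finset.univ.filter fun i => a i q = 0

theorem mem_zeroSet {q : E n} {i : ι} : i ∈ zeroSet a q ↔ a i q = 0 := by simp [zeroSet]

/-- The smallest flat through a point. -/
def flatThrough (a : ι → E n →L[ℝ] ℝ) (q : E n) : Submodule ℝ (E n) := zeroSpace a (zeroSet a q)

theorem mem_flatThrough {q v : E n} : v ∈ flatThrough a q ↔ ∀ i, a i q = 0 → a i v = 0 := by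
  simp [flatThrough, mem_zeroSpace, mem_zeroSet]

theorem self_mem_flatThrough (q : E n) : q ∈ flatThrough a q := mem_flatThrough.2 fun _ h => h

theorem exists_add_smul_mem_cone {s : ι → SignType} {q v : E n} (hq : q ∈ cone a s)
    (hv : ∀ i, s i ≠ 0 → a i q = 0 → a i v = 0) :
    ∃ ε > 0, ∀ c : ℝ, |c| ≤ ε → q + c • v ∈ cone a s := by
  obtain ⟨ε, hε, h⟩ := exists_signs_stable (a := a) q v
  refine ⟨ε, hε, fun c hc i => ?_⟩
  by_cases h0 : a i q = 0
  · by_cases hi : s i = 0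
    · simp [hi]
    · simp [h0, hv i hi h0]
  · exact (sign_mul_nonneg_iff_of_sign_eq (h c hc i h0)).2 (hq i)

theorem vectorSpan_eq_of_mem_interior {F : Set (E n)} {Y : Submodule ℝ (E n)} {q : E n}
    (hF : F ⊆ Y) (hq : q ∈ F) (h : ∀ v ∈ Y, ∃ ε > (0 : ℝ), q + ε • v ∈ F) :
    vectorSpan ℝ F = Y := by
  apply le_antisymm
  · rw [vectorSpan_def, Submodule.span_le]
    rintro _ ⟨x, hx, y, hy, rfl⟩
    exact Y.sub_mem (hF hx) (hF hy)
  · intro v hv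
    obtain ⟨ε, hε, h1⟩ := h v hv
    have h2 := vsub_mem_vectorSpan ℝ h1 hq
    rw [vsub_eq_sub, add_sub_cancel_left] at h2
    have h3 := (vectorSpan ℝ F).smul_mem ε⁻¹ h2
    rwa [smul_smul, inv_mul_cancel₀ hε.ne', one_smul] at h3

theorem exists_extend_of_mem_intrinsicInterior {F : Set (E n)} {q z : E n}
    (hq : q ∈ intrinsicInterior ℝ F) (hz : z ∈ F) : ∃ ε > (0 : ℝ), q + ε • (q - z) ∈ F := by
  obtain ⟨y, hy, rfl⟩ := mem_intrinsicInterior.1 hq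
  have hmem : ∀ c : ℝ, c • ((y : E n) -ᵥ z) +ᵥ (y : E n) ∈ affineSpan ℝ F := fun c =>
    AffineSubspace.smul_vsub_vadd_mem _ c y.2 (subset_affineSpan ℝ F hz) y.2
  let φ : ℝ → affineSpan ℝ F := fun c => ⟨_, hmem c⟩
  have hφ : Continuous φ := by
    refine Continuous.subtype_mk ?_ _
    simp only [vsub_eq_sub, vadd_eq_add]
    fun_prop
  have h0 : φ 0 = y := Subtype.ext (by simp [φ])
  have h1 : ∀ᶠ c in nhds (0 : ℝ), φ c ∈ interior ((↑) ⁻¹' F : Set (affineSpan ℝ F)) :=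
    hφ.continuousAt.eventually_mem (by rw [h0]; exact isOpen_interior.mem_nhds hy)
  obtain ⟨δ, hδ, h2⟩ := Metric.eventually_nhds_iff.1 h1
  refine ⟨δ / 2, by positivity, ?_⟩
  have h3 := interior_subset (h2 (y := δ / 2) (by
    rw [Real.dist_eq, sub_zero, abs_of_pos (by positivity)]; linarith))
  simpa [φ, add_comm] using h3

/-- The face whose relative interior contains `q` is cut out of the cone by the smallest flat
through `q`, so the flat is its span. Non-zero signs are needed: at a zero sign the cone ignores the
functional while the flat does not. -/
theorem inRelintOfFace_cone_iff {s : ι → SignType} (hs : ∀ i, s i ≠ 0) {k : ℕ} {q : E n} :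
    InRelintOfFace (cone a s) k q ↔
      q ∈ cone a s ∧ Module.finrank ℝ (flatThrough a q) = k := by
  constructor
  · rintro ⟨F, hF, hq, rfl⟩
    have hqF := intrinsicInterior_subset hq
    obtain ⟨l, hl⟩ := hF ⟨q, hqF⟩
    have hqK : q ∈ cone a s := (hl ▸ hqF : q ∈ {x ∈ cone a s | ∀ y ∈ cone a s, l y ≤ l x}).1
    have hmax : ∀ y ∈ cone a s, l y ≤ l q :=
      (hl ▸ hqF : q ∈ {x ∈ cone a s | ∀ y ∈ cone a s, l y ≤ l x}).2
    have hFK : F ⊆ cone a s := by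
      rw [hl]; exact fun x hx => hx.1
    refine ⟨hqK, ?_⟩
    rw [vectorSpan_eq_of_mem_interior (Y := flatThrough a q) _ hqF]
    · intro v hv
      obtain ⟨ε, hε, h⟩ := exists_add_smul_mem_cone hqK fun i _ => mem_flatThrough.1 hv i
      have h1 := h ε (abs_of_pos hε).le
      have h2 := h (-ε) (by rw [abs_neg, abs_of_pos hε])
      have h3 := hmax _ h1
      have h4 := hmax _ h2
      simp only [map_add, map_smul, smul_eq_mul] at h3 h4
      have h5 : l v = 0 := by nlinarith
      refine ⟨ε, hε, ?_⟩
      rw [hl]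
      exact ⟨h1, fun y hy => by simpa [h5] using hmax y hy⟩
    · intro z hz
      refine mem_flatThrough.2 fun i hi => ?_
      obtain ⟨ε, hε, h⟩ := exists_extend_of_mem_intrinsicInterior hq hz
      -- Moving from `q` towards and away from `z` stays in the cone, so a functional vanishing at
      -- `q` also vanishes at `z`.
      have h1 := hFK h i
      have h2 := hFK hz i
      simp only [map_add, map_smul, map_sub, smul_eq_mul, hi] at h1
      have h3 : (s i : ℝ) * a i z = 0 := by nlinarith
      exact (mul_eq_zero.1 h3).resolve_left (cast_sign_ne_zero (hs i))
  · rintro ⟨hq, rfl⟩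
    set F : Set (E n) := cone a s ∩ flatThrough a q with hF
    have hqF : q ∈ F := ⟨hq, self_mem_flatThrough q⟩
    have hspan : vectorSpan ℝ F = flatThrough a q := by
      refine vectorSpan_eq_of_mem_interior Set.inter_subset_right hqF fun v hv => ?_
      obtain ⟨ε, hε, h⟩ := exists_add_smul_mem_cone hq fun i _ => mem_flatThrough.1 hv i
      exact ⟨ε, hε, h ε (abs_of_pos hε).le,
        Submodule.add_mem _ (self_mem_flatThrough q) (Submodule.smul_mem _ _ hv)⟩
    -- On the cone every signed functional is non-negative, so this functional has maximum zero,
    -- attained exactly where all functionals vanishing at `q` vanish.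
    refine ⟨F, fun _ => ⟨-∑ i ∈ zeroSet a q, (s i : ℝ) • a i, ?_⟩, ?_, by rw [hspan]⟩
    · have hl : ∀ x, (-∑ i ∈ zeroSet a q, (s i : ℝ) • a i : StrongDual ℝ (E n)) x =
          -∑ i ∈ zeroSet a q, (s i : ℝ) * a i x := fun x => by simp
      have hpos : ∀ x ∈ cone a s, 0 ≤ ∑ i ∈ zeroSet a q, (s i : ℝ) * a i x := fun x hx =>
        Finset.sum_nonneg fun i _ => hx i
      ext x
      simp only [hl, hF, Set.mem_inter_iff, Set.mem_ofPred_eq, SetLike.mem_coe]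
      refine and_congr_right fun hx => ⟨fun hxY y hy => ?_, fun h => ?_⟩
      · rw [Finset.sum_eq_zero (s := zeroSet a q) (f := fun i => (s i : ℝ) * a i x) fun i hi => by
          rw [mem_flatThrough.1 hxY i (mem_zeroSet.1 hi), mul_zero]]
        have := hpos y hy
        linarith
      · have h0 := h 0 (zero_mem_cone s)
        simp only [map_zero, mul_zero, Finset.sum_const_zero, neg_zero] at h0
        have h1 := le_antisymm (by linarith) (hpos x hx)
        have h2 := (Finset.sum_eq_zero_iff_of_nonneg fun i _ => hx i).1 h1
        refine mem_flatThrough.2 fun i hi => ?_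
        exact (mul_eq_zero.1 (h2 i (mem_zeroSet.2 hi))).resolve_left (cast_sign_ne_zero (hs i))
    · refine mem_intrinsicInterior.2 ⟨⟨q, subset_affineSpan ℝ F hqF⟩, ?_, rfl⟩
      rw [mem_interior_iff_mem_nhds]
      have hsub : affineSpan ℝ F ≤ (flatThrough a q).toAffineSubspace :=
        affineSpan_le.2 Set.inter_subset_right
      have hev : ∀ i, ∀ᶠ w in nhds q, a i q ≠ 0 → 0 ≤ (s i : ℝ) * a i w := by
        intro i
        by_cases h0 : a i q = 0
        · simp [h0]
        · have hlt : 0 < (s i : ℝ) * a i q := 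
            lt_of_le_of_ne (hq i) (mul_ne_zero (cast_sign_ne_zero (hs i)) h0).symm
          have hc : Continuous fun w => (s i : ℝ) * a i w := by fun_prop
          filter_upwards [hc.continuousAt.eventually (lt_mem_nhds hlt)] with w hw _
          exact hw.le
      have hev2 : ∀ᶠ w : affineSpan ℝ F in nhds ⟨q, subset_affineSpan ℝ F hqF⟩,
          ∀ i, a i q ≠ 0 → 0 ≤ (s i : ℝ) * a i w :=
        (continuous_subtype_val.continuousAt (x := (⟨q, subset_affineSpan ℝ F hqF⟩ :
          affineSpan ℝ F))).eventually (Filter.eventually_all.2 hev)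
      filter_upwards [hev2] with w hw
      have hwY : (w : E n) ∈ flatThrough a q := hsub w.2
      refine ⟨fun i => ?_, hwY⟩
      by_cases h0 : a i q = 0
      · rw [mem_flatThrough.1 hwY i h0, mul_zero]
      · exact hw i h0

end Cones

/-! ### Counting chambers by the smallest flat through the nearest point. -/

section ProjectionCount

variable {n : ℕ} {ι : Type*} {a : ι → E n →L[ℝ] ℝ}

/-- The nearest point of a cone. -/
def proj (a : ι → E n →L[ℝ] ℝ) (s : ι → SignType) (x : E n) : E n :=
  (exists_isProjection_cone (a := a) s x).choose

theorem isProjection_proj (s : ι → SignType) (x : E n) :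
    IsProjection (cone a s) x (proj a s x) := (exists_isProjection_cone (a := a) s x).choose_spec

theorem isProjection_cone_iff {s : ι → SignType} {x q : E n} :
    IsProjection (cone a s) x q ↔ proj a s x = q :=
  ⟨fun h => (isProjection_proj s x).unique (convex_cone s) h, fun h => h ▸ isProjection_proj s x⟩

/-- The obtuse-angle criterion involves only the directions `z - q` up to positive scaling, so it
sees only the set near `q`. -/
theorem isProjection_iff_of_locally_eq {K L : Set (E n)} (hK : Convex ℝ K) (hL : Convex ℝ L)
    (hKL : K ⊆ L) {x q : E n} (hq : q ∈ K)
    (h : ∀ z ∈ L, ∃ ε > (0 : ℝ), q + ε • (z - q) ∈ K) :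
    IsProjection K x q ↔ IsProjection L x q := by
  rw [isProjection_iff hK, isProjection_iff hL]
  refine ⟨fun ⟨_, h1⟩ => ⟨hKL hq, fun z hz => ?_⟩, fun ⟨_, h1⟩ => ⟨hq, fun z hz => h1 z (hKL hz)⟩⟩
  obtain ⟨ε, hε, h2⟩ := h z hz
  have h3 := h1 _ h2
  rw [add_sub_cancel_left, inner_smul_right] at h3
  exact nonpos_of_mul_nonpos_right h3 hε

/-- Replace the signs outside `J` by zero. -/
def restrictSigns (J : Finset ι) (s : ι → SignType) (i : ι) : SignType := if i ∈ J then s i else 0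

theorem cone_subset_cone_restrictSigns (J : Finset ι) (s : ι → SignType) :
    cone a s ⊆ cone a (restrictSigns J s) := by
  intro z hz i
  by_cases hi : i ∈ J
  · simpa [restrictSigns, hi] using hz i
  · simp [restrictSigns, hi]

theorem eq_sign_of_mul_nonneg {σ : SignType} {u : ℝ} (hσ : σ ≠ 0) (hu : u ≠ 0)
    (h : 0 ≤ (σ : ℝ) * u) : σ = SignType.sign u := by
  rcases lt_or_gt_of_ne hu with hu | hu
  · rw [sign_neg hu]
    rcases σ <;> simp_all
    linarith
  · rw [sign_pos hu]
    rcases σ <;> simp_all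
    linarith

variable [Fintype ι]

theorem restrictSigns_signOn (J : Finset ι) (p : E n) :
    restrictSigns J (signOn a Finset.univ p) = signOn a J p := by
  ext i
  simp [restrictSigns, signOn]

theorem mem_chambers {J : Finset ι} {s : ι → SignType} :
    s ∈ chambers a J ↔ (∃ p, signOn a J p = s) ∧ ∀ i ∈ J, s i ≠ 0 := by
  simp [chambers, mem_covectors]

/-- Near a point on no hyperplane outside `J`, a chamber coincides with the chamber of the
arrangement `J` containing it. -/
theorem isProjection_cone_iff_restrictSigns {J : Finset ι} {s : ι → SignType} {x q : E n}
    (hq : q ∈ cone a s) (hJ : zeroSet a q ⊆ J) :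
    IsProjection (cone a s) x q ↔ IsProjection (cone a (restrictSigns J s)) x q := by
  refine isProjection_iff_of_locally_eq (convex_cone s) (convex_cone _)
    (cone_subset_cone_restrictSigns J s) hq fun z hz => ?_
  obtain ⟨ε, hε, h⟩ := exists_signs_stable (a := a) q (z - q)
  refine ⟨ε, hε, fun i => ?_⟩
  by_cases h0 : a i q = 0
  · have h1 := hz i
    rw [restrictSigns, if_pos (hJ (mem_zeroSet.2 h0))] at h1
    simp only [map_add, map_smul, map_sub, smul_eq_mul, h0, zero_add, sub_zero]
    nlinarith
  · exact (sign_mul_nonneg_iff_of_sign_eq (h ε (abs_of_pos hε).le i h0)).2 (hq i)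

/-- From `q` one can move both ways along every direction of the flat and stay in the cone. The
obtuse-angle inequality in both directions gives orthogonality. -/
theorem starProjection_eq_of_isProjection {J : Finset ι} {s : ι → SignType} {x q : E n}
    (hs : ∀ i ∉ J, s i = 0) (hq : IsProjection (cone a s) x q) :
    (zeroSpace a (J ∩ zeroSet a q)).starProjection x = q := by
  rw [isProjection_iff (convex_cone s)] at hq
  refine Submodule.eq_starProjection_of_mem_of_inner_eq_zero
    (fun i hi => mem_zeroSet.1 (Finset.mem_inter.1 hi).2) fun v hv => ?_
  obtain ⟨ε, hε, h⟩ := exists_add_smul_mem_cone (v := v) hq.1 fun i hi h0 =>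
    hv i (Finset.mem_inter.2 ⟨by_contra fun h => hi (hs i h), mem_zeroSet.2 h0⟩)
  have h1 := hq.2 _ (h ε (abs_of_pos hε).le)
  have h2 := hq.2 _ (h (-ε) (by rw [abs_neg, abs_of_pos hε]))
  rw [add_sub_cancel_left, inner_smul_right] at h1 h2
  nlinarith

variable (a) in
/-- A point is generic when its projections onto flats lie on no further hyperplanes. -/
def IsGeneric (x : E n) : Prop :=
  ∀ (S : Finset ι) (i : ι), ¬ zeroSpace a S ≤ (a i).ker → a i ((zeroSpace a S).starProjection x) ≠ 0

variable (a) in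
/-- The proper subspaces which have to be avoided by a generic point. -/
def exceptional : Finset (Submodule ℝ (E n)) :=
  ((Finset.univ : Finset (Finset ι × ι)).image fun p =>
    ((a p.2).comp (zeroSpace a p.1).starProjection).ker).filter (· ≠ ⊤)

/-- The exceptional kernel is proper because the projection fixes a vector of the flat on which `a
i` is non-zero. -/
theorem isGeneric_of_forall_notMem {x : E n} (hx : ∀ H ∈ exceptional a, x ∉ H) :
    IsGeneric a x := by
  intro S i hSi h0
  obtain ⟨v, hv, hv0⟩ := SetLike.not_le_iff_exists.1 hSi
  refine hx ((a i).comp (zeroSpace a S).starProjection).ker (Finset.mem_filter.2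
    ⟨Finset.mem_image.2 ⟨(S, i), Finset.mem_univ _, rfl⟩, fun htop => hv0 ?_⟩) h0
  have h1 : v ∈ ((a i).comp (zeroSpace a S).starProjection).ker := htop ▸ Submodule.mem_top
  have h2 : a i ((zeroSpace a S).starProjection v) = 0 := h1
  rwa [Submodule.starProjection_eq_self_iff.2 hv] at h2

theorem le_flatThrough_iff {L : Submodule ℝ (E n)} {q : E n} :
    L ≤ flatThrough a q ↔ zeroSet a q ⊆ vanishing a L := le_zeroSpace_iff

/-- The chambers whose nearest point to `x` is on a face containing directions of `L` correspond
to the chambers of the localization at `L`. -/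
theorem card_le_flatThrough_proj {x : E n} (hx : IsGeneric a x) (L : Submodule ℝ (E n)) :
    ((chambers a Finset.univ).filter fun s => L ≤ flatThrough a (proj a s x)).card =
      (chambers a (vanishing a L)).card := by
  set J := vanishing a L with hJ
  have hproj : ∀ s, L ≤ flatThrough a (proj a s x) →
      proj a (restrictSigns J s) x = proj a s x := by
    intro s hL
    rw [← isProjection_cone_iff, ← isProjection_cone_iff_restrictSigns (isProjection_proj s x).1
      (le_flatThrough_iff.1 hL)]
    exact isProjection_proj s x
  refine Finset.card_bij (fun s _ => restrictSigns J s) ?_ ?_ ?_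
  · intro s hs
    obtain ⟨⟨p, rfl⟩, h0⟩ := mem_chambers.1 (Finset.mem_filter.1 hs).1
    refine mem_chambers.2 ⟨⟨p, (restrictSigns_signOn J p).symm⟩, fun i hi => ?_⟩
    rw [restrictSigns, if_pos hi]
    exact h0 i (Finset.mem_univ i)
  · intro s hs t ht hst
    obtain ⟨hs, hsL⟩ := Finset.mem_filter.1 hs
    obtain ⟨ht, htL⟩ := Finset.mem_filter.1 ht
    have hq : proj a s x = proj a t x := by rw [← hproj s hsL, ← hproj t htL, hst]
    ext i
    by_cases hi : i ∈ J
    · simpa [restrictSigns, hi] using congrFun hst i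
    -- Outside `J` the common nearest point lies on no hyperplane and belongs to both cones, so it
    -- determines both signs.
    · have h0 : a i (proj a s x) ≠ 0 := fun h0 => hi (le_flatThrough_iff.1 hsL (mem_zeroSet.2 h0))
      rw [eq_sign_of_mul_nonneg ((mem_chambers.1 hs).2 i (Finset.mem_univ i)) h0
        ((isProjection_proj s x).1 i),
        eq_sign_of_mul_nonneg ((mem_chambers.1 ht).2 i (Finset.mem_univ i)) (hq ▸ h0)
        ((isProjection_proj t x).1 i), hq]
  · intro t ht
    obtain ⟨⟨p, hp⟩, ht0⟩ := mem_chambers.1 ht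
    have htJ : ∀ i ∉ J, t i = 0 := fun i hi => by rw [← hp]; simp [signOn, hi]
    set q := proj a t x with hq
    have hqt : q ∈ cone a t := (isProjection_proj t x).1
    have hstar := starProjection_eq_of_isProjection htJ (isProjection_proj (a := a) t x)
    -- `q` is the orthogonal projection of `x` to a flat containing `L`, and that flat lies in no
    -- hyperplane outside `J`; genericity applies.
    have hoff : ∀ i ∉ J, a i q ≠ 0 := by
      intro i hi
      have h1 : L ≤ zeroSpace a (J ∩ zeroSet a q) := le_zeroSpace_iff.2 Finset.inter_subset_left
      have h2 := hx (J ∩ zeroSet a q) i fun h => hi (mem_vanishing.2 fun y hy => h (h1 hy))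
      rwa [hstar] at h2
    obtain ⟨ε, hε, h⟩ := exists_signs_stable (a := a) q p
    -- Moving from `q` slightly towards the interior point `p` makes the signs in `J` strict and
    -- keeps those outside `J`; the chamber of `r` is the required preimage.
    set r := q + ε • p with hr
    have hrJ : ∀ i ∈ J, SignType.sign (a i r) = t i := by
      intro i hi
      have h1 := hqt i
      have h2 := ht0 i hi
      rw [← hp] at h1 h2 ⊢
      simp only [signOn, hi, if_true] at h1 h2 ⊢
      have h3 := sign_ne_zero.1 h2
      simp only [hr, map_add, map_smul, smul_eq_mul]
      rcases lt_or_gt_of_ne h3 with h3 | h3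
      · rw [sign_neg h3] at h1 ⊢
        simp at h1
        exact sign_neg (by nlinarith)
      · rw [sign_pos h3] at h1 ⊢
        simp at h1
        exact sign_pos (by nlinarith)
    have hroff : ∀ i ∉ J, SignType.sign (a i r) = SignType.sign (a i q) := fun i hi =>
      h ε (abs_of_pos hε).le i (hoff i hi)
    have hres : restrictSigns J (signOn a Finset.univ r) = t := by
      ext i
      by_cases hi : i ∈ J
      · simp [restrictSigns, hi, signOn_univ, hrJ i hi]
      · simp [restrictSigns, hi, htJ i hi]
    have hqs : q ∈ cone a (signOn a Finset.univ r) := by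
      intro i
      rw [signOn_univ]
      by_cases hi : i ∈ J
      · rw [hrJ i hi]
        exact hqt i
      · rw [hroff i hi]
        exact sign_mul_self_nonneg _
    have hzero : zeroSet a q ⊆ J := fun i hi => by_contra fun h => hoff i h (mem_zeroSet.1 hi)
    have hpr : proj a (signOn a Finset.univ r) x = q := by
      rw [← isProjection_cone_iff, isProjection_cone_iff_restrictSigns hqs hzero, hres]
      exact isProjection_proj t x
    refine ⟨signOn a Finset.univ r, Finset.mem_filter.2 ⟨mem_chambers.2 ⟨⟨r, rfl⟩, fun i _ => ?_⟩,
      ?_⟩, hres⟩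
    · rw [signOn_univ]
      by_cases hi : i ∈ J
      · rw [hrJ i hi]
        exact ht0 i hi
      · rw [hroff i hi]
        exact sign_ne_zero.2 (hoff i hi)
    · rw [hpr]
      exact le_flatThrough_iff.2 hzero

theorem neg_one_pow_mul_self (m : ℕ) : (-1 : ℤ) ^ m * (-1) ^ m = 1 := by
  rw [← mul_pow]; simp

/-- The number of chambers whose nearest point to `x` spans a given flat. -/
theorem card_flatThrough_proj_eq (ha : ∀ i, a i ≠ 0) {x : E n} (hx : IsGeneric a x)
    (Y : {X // X ∈ intersections (kernels a)}) :
    (((chambers a Finset.univ).filter fun s => flatThrough a (proj a s x) = flat Y).card : ℤ) =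
      (-1) ^ n * (mobius (kernels a) Y * (-1) ^ Module.finrank ℝ (flat Y)) := by
  induction Y using WellFoundedLT.induction with
  | _ Y ih =>
    have hex : ∀ s, ∃ Y : {X // X ∈ intersections (kernels a)},
        flat Y = flatThrough a (proj a s x) :=
      fun s => exists_flat_eq a (zeroSet a (proj a s x))
    choose f hf using hex
    have hfY : ∀ s Z, flatThrough a (proj a s x) = flat Z ↔ f s = Z := fun s Z =>
      ⟨fun h => flat_injective ((hf s).trans h), fun h => h ▸ (hf s).symm⟩
    -- Both sides have equal sums over the flats containing `Y`. The induction runs from larger to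
    -- smaller subspaces, so all terms but the one at `Y` already agree.
    have h1 : ∑ Z : {X // X ∈ intersections (kernels a)} with flat Y ≤ flat Z,
        (((chambers a Finset.univ).filter fun s =>
          flatThrough a (proj a s x) = flat Z).card : ℤ) =
        ∑ Z : {X // X ∈ intersections (kernels a)} with flat Y ≤ flat Z,
          (-1) ^ n * (mobius (kernels a) Z * (-1) ^ Module.finrank ℝ (flat Z)) := by
      rw [← Finset.mul_sum, sum_mobius_sign ha, ← mul_assoc, neg_one_pow_mul_self, one_mul,
        ← card_le_flatThrough_proj hx, Finset.card_eq_sum_card_fiberwise (f := f)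
        (t := Finset.univ.filter fun Z => flat Y ≤ flat Z), Nat.cast_sum]
      · refine Finset.sum_congr rfl fun Z hZ => ?_
        congr 2
        ext s
        simp only [Finset.mem_filter, ← hfY]
        refine ⟨fun ⟨h1, h2⟩ => ⟨⟨h1, h2 ▸ (Finset.mem_filter.1 hZ).2⟩, h2⟩,
          fun ⟨⟨h1, _⟩, h2⟩ => ⟨h1, h2⟩⟩
      · intro s hs
        have := (Finset.mem_filter.1 hs).2
        simpa [hf s] using this
    rw [← sub_eq_zero, ← Finset.sum_sub_distrib, Finset.sum_eq_single Y] at h1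
    · exact sub_eq_zero.1 h1
    · intro Z hZ hne
      exact sub_eq_zero.2 (ih Z (lt_of_le_of_ne (flat_le_flat.1 (Finset.mem_filter.1 hZ).2) hne))
    · intro h
      exact absurd (by simp) h

theorem card_finrank_flatThrough_proj (ha : ∀ i, a i ≠ 0) {x : E n} (hx : IsGeneric a x) (k : ℕ) :
    (((chambers a Finset.univ).filter fun s =>
      Module.finrank ℝ (flatThrough a (proj a s x)) = k).card : ℤ) =
      |(charPoly (kernels a)).coeff k| := by
  have hex : ∀ s, ∃ Y : {X // X ∈ intersections (kernels a)}, flat Y = flatThrough a (proj a s x) :=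
    fun s => exists_flat_eq a (zeroSet a (proj a s x))
  choose f hf using hex
  have hfY : ∀ s Z, flatThrough a (proj a s x) = flat Z ↔ f s = Z := fun s Z =>
    ⟨fun h => flat_injective ((hf s).trans h), fun h => h ▸ (hf s).symm⟩
  have h1 : (((chambers a Finset.univ).filter fun s =>
      Module.finrank ℝ (flatThrough a (proj a s x)) = k).card : ℤ) =
      (-1) ^ n * (-1) ^ k * (charPoly (kernels a)).coeff k := by
    rw [Finset.card_eq_sum_card_fiberwise (f := f)
      (t := Finset.univ.filter fun Z => Module.finrank ℝ (flat Z) = k), Nat.cast_sum,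
      charPoly_eq, finsetSum_coeff, Finset.mul_sum, Finset.sum_filter]
    · refine Finset.sum_congr rfl fun Z _ => ?_
      rw [coeff_C_mul, coeff_X_pow]
      split_ifs with h1 h2 h2
      · rw [mul_one, mul_assoc, mul_comm _ (mobius _ _), ← h1, ← card_flatThrough_proj_eq ha hx]
        congr 2
        ext s
        simp only [Finset.mem_filter, ← hfY]
        refine ⟨fun ⟨⟨h3, _⟩, h2⟩ => ⟨h3, h2⟩, fun ⟨h3, h2⟩ => ⟨⟨h3, ?_⟩, h2⟩⟩
        rw [h2, h1]
      · exact absurd h1.symm h2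
      · exact absurd h2.symm h1
      · simp
    · intro s hs
      have := (Finset.mem_filter.1 hs).2
      exact Finset.mem_coe.2 (Finset.mem_filter.2 ⟨Finset.mem_univ _, by rw [hf]; exact this⟩)
  have h2 := congrArg abs h1
  rwa [abs_mul, abs_mul, abs_pow, abs_pow, abs_neg, abs_one, one_pow, one_pow, one_mul, one_mul,
    Nat.abs_cast] at h2

end ProjectionCount

/-! ### Counting integer vectors with distinct absolute values. -/

section Counting

/-- Integer vectors with entries in `A` whose absolute values are distinct. -/
def absInjective (n : ℕ) (A : Finset ℤ) : Finset (Fin n → ℤ) :=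
  (Fintype.piFinset fun _ => A).filter fun x => Function.Injective fun i => (x i).natAbs

/-- The entries that may accompany an entry `b`. -/
def eraseAbs (A : Finset ℤ) (b : ℤ) : Finset ℤ := A.filter fun c => c.natAbs ≠ b.natAbs

theorem mem_absInjective {n : ℕ} {A : Finset ℤ} {x : Fin n → ℤ} :
    x ∈ absInjective n A ↔ (∀ i, x i ∈ A) ∧ Function.Injective fun i => (x i).natAbs := by
  simp [absInjective]

theorem cons_mem_absInjective {n : ℕ} {A : Finset ℤ} {b : ℤ} {x : Fin n → ℤ} :
    (Fin.cons b x : Fin (n + 1) → ℤ) ∈ absInjective (n + 1) A ↔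
      b ∈ A ∧ x ∈ absInjective n (eraseAbs A b) := by
  have h : (fun i => ((Fin.cons b x : Fin (n + 1) → ℤ) i).natAbs) =
      Fin.cons b.natAbs fun i => (x i).natAbs := by
    ext i
    refine Fin.cases ?_ (fun i => ?_) i <;> simp
  rw [mem_absInjective, mem_absInjective, h, Fin.cons_injective_iff, Fin.forall_fin_succ]
  simp only [Fin.cons_zero, Fin.cons_succ, Set.mem_range, not_exists, eraseAbs, Finset.mem_filter,
    ne_eq, forall_and]
  tauto

theorem card_absInjective_succ (n : ℕ) (A : Finset ℤ) :
    (absInjective (n + 1) A).card = ∑ b ∈ A, (absInjective n (eraseAbs A b)).card := by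
  rw [Finset.card_eq_sum_card_fiberwise (f := fun x => x 0) (t := A)
    fun x hx => (mem_absInjective.1 hx).1 0]
  refine Finset.sum_congr rfl fun b hb => (Finset.card_bij (fun x _ => Fin.cons b x) ?_ ?_ ?_).symm
  · intro x hx
    exact Finset.mem_filter.2 ⟨cons_mem_absInjective.2 ⟨hb, hx⟩, rfl⟩
  · intro x _ y _ h
    exact (Fin.cons_injective2 h).2
  · intro x hx
    obtain ⟨hxA, rfl⟩ := Finset.mem_filter.1 hx
    refine ⟨Fin.tail x, ?_, Fin.cons_self_tail x⟩
    exact (cons_mem_absInjective.1 ((Fin.cons_self_tail x).symm ▸ hxA)).2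

theorem card_eraseAbs {A : Finset ℤ} (hA : ∀ b ∈ A, -b ∈ A) {b : ℤ} (hb : b ∈ A) (h0 : b ≠ 0) :
    (eraseAbs A b).card + 2 = A.card := by
  have h : eraseAbs A b = A \ {b, -b} := by
    ext c
    simp only [eraseAbs, ne_eq, Int.natAbs_eq_natAbs_iff, Finset.mem_filter, Finset.mem_sdiff,
      Finset.mem_insert, Finset.mem_singleton]
  have h2 : ({b, -b} : Finset ℤ).card = 2 := Finset.card_pair (by omega)
  rw [h, ← h2]
  exact Finset.card_sdiff_add_card_eq_card (by
    intro c hc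
    rcases Finset.mem_insert.1 hc with rfl | hc
    · exact hb
    · exact Finset.mem_singleton.1 hc ▸ hA b hb)

theorem neg_mem_eraseAbs {A : Finset ℤ} (hA : ∀ b ∈ A, -b ∈ A) (b : ℤ) :
    ∀ c ∈ eraseAbs A b, -c ∈ eraseAbs A b := by
  intro c hc
  obtain ⟨h1, h2⟩ := Finset.mem_filter.1 hc
  exact Finset.mem_filter.2 ⟨hA c h1, by simpa using h2⟩

/-- Each chosen entry excludes itself and its negative from later choices. For `k < n` the product
contains the factor zero, so no size condition is needed. -/
theorem card_absInjective_of_notMem (n : ℕ) : ∀ (A : Finset ℤ) (k : ℕ), (∀ b ∈ A, -b ∈ A) →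
    0 ∉ A → A.card = 2 * k →
    ((absInjective n A).card : ℤ) = ∏ i ∈ Finset.range n, (2 * (k : ℤ) - 2 * i) := by
  induction n with
  | zero =>
    intro A k _ _ _
    have : absInjective 0 A = {Fin.elim0} := by
      ext x
      simp [mem_absInjective, Function.Injective, Subsingleton.elim x Fin.elim0]
    rw [this]
    simp
  | succ n ih =>
    intro A k hA h0 hk
    rw [card_absInjective_succ, Nat.cast_sum]
    have hb : ∀ b ∈ A, ((absInjective n (eraseAbs A b)).card : ℤ) =
        ∏ i ∈ Finset.range n, (2 * (k : ℤ) - 2 * (i + 1 : ℕ)) := by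
      intro b hb
      have hc := card_eraseAbs hA hb fun h => h0 (h ▸ hb)
      rw [ih _ (k - 1) (neg_mem_eraseAbs hA b) (fun h => h0 (Finset.mem_filter.1 h).1) (by omega)]
      refine Finset.prod_congr rfl fun i _ => ?_
      push_cast [Nat.cast_sub (show 1 ≤ k by omega)]
      ring
    rw [Finset.sum_congr rfl hb, Finset.sum_const, hk, Finset.prod_range_succ']
    push_cast
    simp only [nsmul_eq_mul]
    push_cast
    ring

theorem card_absInjective_of_mem (n : ℕ) : ∀ (A : Finset ℤ) (k : ℕ), (∀ b ∈ A, -b ∈ A) →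
    0 ∈ A → A.card = 2 * k + 1 →
    ((absInjective (n + 1) A).card : ℤ) =
      (∏ i ∈ Finset.range n, (2 * (k : ℤ) - 2 * i)) * (2 * k - n + 1) := by
  have hzero : ∀ (n : ℕ) (A : Finset ℤ) (k : ℕ), (∀ b ∈ A, -b ∈ A) →
      0 ∈ A → A.card = 2 * k + 1 → ((absInjective n (eraseAbs A 0)).card : ℤ) =
        ∏ i ∈ Finset.range n, (2 * (k : ℤ) - 2 * i) := by
    intro n A k hA h0 hk
    have h1 : eraseAbs A 0 = A.erase 0 := by
      ext c
      simp [eraseAbs, and_comm]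
    refine card_absInjective_of_notMem n _ k (neg_mem_eraseAbs hA 0) (by simp [eraseAbs]) ?_
    rw [h1, Finset.card_erase_of_mem h0]
    omega
  induction n with
  | zero =>
    intro A k hA h0 hk
    have : ∀ B : Finset ℤ, absInjective 0 B = {Fin.elim0} := by
      intro B
      ext x
      simp [mem_absInjective, Function.Injective, Subsingleton.elim x Fin.elim0]
    rw [card_absInjective_succ]
    simp [this, hk]
  | succ n ih =>
    intro A k hA h0 hk
    -- A first entry zero leaves only non-zero values; each of the `2 k` other first entries leaves
    -- zero and `k - 1` pairs.
    rw [card_absInjective_succ, Nat.cast_sum, ← Finset.add_sum_erase _ _ h0,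
      hzero _ A k hA h0 hk]
    have hb : ∀ b ∈ A.erase 0, ((absInjective (n + 1) (eraseAbs A b)).card : ℤ) =
        (∏ i ∈ Finset.range n, (2 * (k : ℤ) - 2 * (i + 1 : ℕ))) * (2 * k - n - 1) := by
      intro b hb
      obtain ⟨hb0, hb⟩ := Finset.mem_erase.1 hb
      have hc := card_eraseAbs hA hb hb0
      rw [ih _ (k - 1) (neg_mem_eraseAbs hA b)
        (Finset.mem_filter.2 ⟨h0, by simpa [eq_comm] using hb0⟩) (by omega)]
      push_cast [Nat.cast_sub (show 1 ≤ k by omega)]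
      congr 1
      · refine Finset.prod_congr rfl fun i _ => ?_
        ring
      · ring
    rw [Finset.sum_congr rfl hb, Finset.sum_const, Finset.card_erase_of_mem h0, hk,
      Finset.prod_range_succ']
    simp only [nsmul_eq_mul, Nat.add_sub_cancel]
    push_cast
    ring

end Counting

/-! ### Parametrization of the flats of `D_n`, over the reals and the integers. -/

section Lift

variable {n : ℕ} (p : Fin n → ℝ)

/-- The free parameters of the smallest flat of `D_n` through `p`. -/
def parameters : Finset ℝ :=
  (Finset.univ.image fun i => |p i|).filter fun t => t = 0 → ∀ i j, p i = 0 → p j = 0 → i = j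

/-- The sign of a real number, which is `1` at zero. -/
def unitSign (u : ℝ) : ℤ := if u < 0 then -1 else 1

theorem unitSign_mul_self (u : ℝ) : unitSign u * unitSign u = 1 := by
  unfold unitSign; split_ifs <;> rfl

theorem unitSign_eq (u : ℝ) : unitSign u = 1 ∨ unitSign u = -1 := by
  unfold unitSign; split_ifs <;> simp

theorem unitSign_neg {u : ℝ} (h : u ≠ 0) : unitSign (-u) = -unitSign u := by
  unfold unitSign
  rcases lt_or_gt_of_ne h with h | h
  · rw [if_pos h, if_neg (by linarith), neg_neg]
  · rw [if_pos (by linarith), if_neg (by linarith)]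

variable {R : Type*} [CommRing R]

/-- The point with given parameters. -/
def lift (y : parameters p → R) (i : Fin n) : R :=
  if h : |p i| ∈ parameters p then (unitSign (p i) : R) * y ⟨|p i|, h⟩ else 0

variable (R) in
/-- The equations of the smallest flat of `D_n` through `p`. -/
def Equations (x : Fin n → R) : Prop :=
  ∀ i j, i ≠ j → (p i = p j → x i = x j) ∧ (p i = -p j → x i = -x j)

variable {p}

/-- `D_n` has no hyperplane `x_i = 0`, so a zero coordinate occurring alone is still free. Two zero
coordinates satisfy both `x_i = x_j` and `x_i = -x_j`, which forces them to vanish on the flat. -/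
theorem mem_parameters {i : Fin n} :
    |p i| ∈ parameters p ↔ (p i = 0 → ∀ j, p j = 0 → j = i) := by
  simp only [parameters, Finset.mem_filter, Finset.mem_image, Finset.mem_univ, true_and,
    exists_apply_eq_apply, abs_eq_zero]
  exact ⟨fun h h0 j hj => h h0 j i hj h0, fun h h0 j k hj hk => (h h0 j hj).trans (h h0 k hk).symm⟩

theorem lift_of_abs_eq {i j : Fin n} (y : parameters p → R) (h : |p i| = |p j|)
    (hi : |p i| ∈ parameters p) :
    lift p y j = (unitSign (p j) : R) * y ⟨|p i|, hi⟩ := by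
  rw [lift, dif_pos (h ▸ hi)]
  congr 2
  exact Subtype.ext h.symm

theorem equations_lift (y : parameters p → R) : Equations p R (lift p y) := by
  intro i j hij
  by_cases hi : |p i| ∈ parameters p
  · refine ⟨fun h => ?_, fun h => ?_⟩
    · rw [lift_of_abs_eq y rfl hi, lift_of_abs_eq y (by rw [h]) hi, congrArg unitSign h]
    · have h0 : p j ≠ 0 := fun h0 => by
        rw [h0, neg_zero] at h
        exact hij (mem_parameters.1 hi h j h0).symm
      rw [lift_of_abs_eq y rfl hi, lift_of_abs_eq y (by rw [h, abs_neg]) hi, congrArg unitSign h,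
        unitSign_neg h0]
      push_cast
      ring
  · have h0 : ∀ h : |p i| = |p j|, lift p y i = 0 ∧ lift p y j = 0 := fun h => by
      constructor
      · rw [lift, dif_neg hi]
      · rw [lift, dif_neg (h ▸ hi)]
    refine ⟨fun h => ?_, fun h => ?_⟩
    · obtain ⟨h1, h2⟩ := h0 (by rw [h])
      rw [h1, h2]
    · obtain ⟨h1, h2⟩ := h0 (by rw [h, abs_neg])
      rw [h1, h2, neg_zero]

theorem exists_index (t : parameters p) : ∃ i, |p i| = t := by
  obtain ⟨i, -, h⟩ := Finset.mem_image.1 (Finset.mem_filter.1 t.2).1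
  exact ⟨i, h⟩

theorem unitSign_mul_lift {i : Fin n} (y : parameters p → R) (hi : |p i| ∈ parameters p) :
    (unitSign (p i) : R) * lift p y i = y ⟨|p i|, hi⟩ := by
  rw [lift_of_abs_eq y rfl hi, ← mul_assoc, ← Int.cast_mul, unitSign_mul_self, Int.cast_one,
    one_mul]

theorem lift_injective : Function.Injective (lift p : (parameters p → R) → Fin n → R) := by
  intro y z h
  ext ⟨t, ht⟩
  obtain ⟨i, rfl⟩ := exists_index ⟨t, ht⟩
  rw [← unitSign_mul_lift y ht, ← unitSign_mul_lift z ht, h]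

theorem exists_lift_eq [NoZeroDivisors R] [CharZero R] {x : Fin n → R} (hx : Equations p R x) :
    ∃ y, lift p y = x := by
  choose f hf using exists_index (p := p)
  -- Each parameter is read off at an arbitrary coordinate with that absolute value; the equations
  -- make the choice immaterial.
  refine ⟨fun t => (unitSign (p (f t)) : R) * x (f t), ?_⟩
  ext i
  by_cases hi : |p i| ∈ parameters p
  · rw [lift_of_abs_eq _ rfl hi]
    have hj : |p (f ⟨|p i|, hi⟩)| = |p i| := hf ⟨|p i|, hi⟩
    generalize f ⟨|p i|, hi⟩ = j at hj
    rw [← mul_assoc]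
    rcases eq_or_ne j i with rfl | hji
    · rw [← Int.cast_mul, unitSign_mul_self, Int.cast_one, one_mul]
    rcases abs_eq_abs.1 hj with h | h
    · rw [h, ← Int.cast_mul, unitSign_mul_self, Int.cast_one, one_mul, (hx j i hji).1 h]
    · have h0 : p i ≠ 0 := fun h0 => by
        rw [h0, neg_zero] at h
        exact hji (mem_parameters.1 hi h0 j h)
      rw [h, unitSign_neg h0, ← Int.cast_mul, mul_neg, unitSign_mul_self, (hx j i hji).2 h]
      simp
  · rw [lift, dif_neg hi]
    rw [mem_parameters] at hi
    push Not at hi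
    obtain ⟨h0, j, hj, hji⟩ := hi
    have h1 := (hx j i hji).1 (by rw [hj, h0])
    have h2 := (hx j i hji).2 (by rw [hj, h0, neg_zero])
    exact (self_eq_neg.1 (h1 ▸ h2 : x j = -x j) ▸ h1.symm ▸ rfl : x i = 0).symm

variable (p) in
-- Parameters and coordinates differ by signs or by inserted zeros, so the parametrization matches
-- the symmetric boxes on both sides.
theorem card_equations (m : ℕ) :
    ((Fintype.piFinset fun _ : Fin n => Finset.Icc (-(m : ℤ)) m).filter
      fun x => Equations p ℤ x).card = (2 * m + 1) ^ (parameters p).card := by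
  have h1 : (Fintype.piFinset fun _ : parameters p => Finset.Icc (-(m : ℤ)) m).card =
      (2 * m + 1) ^ (parameters p).card := by
    rw [Fintype.card_piFinset, Finset.prod_const, Int.card_Icc, Finset.card_univ, Fintype.card_coe]
    congr 1
    omega
  rw [← h1]
  have hbd : ∀ (u : ℝ) (b : ℤ), b ∈ Finset.Icc (-(m : ℤ)) m →
      unitSign u * b ∈ Finset.Icc (-(m : ℤ)) m := by
    intro u b hb
    rw [Finset.mem_Icc] at hb ⊢
    rcases unitSign_eq u with h | h <;> rw [h] <;> constructor <;> linarith
  refine (Finset.card_bij (fun y _ => lift p y) ?_ (fun y _ z _ h => lift_injective h) ?_).symm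
  · intro y hy
    refine Finset.mem_filter.2 ⟨Fintype.mem_piFinset.2 fun i => ?_, equations_lift y⟩
    rw [lift]
    split_ifs with h
    · exact hbd _ _ (Fintype.mem_piFinset.1 hy _)
    · rw [Finset.mem_Icc]
      constructor <;> linarith
  · intro x hx
    obtain ⟨hx, he⟩ := Finset.mem_filter.1 hx
    obtain ⟨y, rfl⟩ := exists_lift_eq he
    refine ⟨y, Fintype.mem_piFinset.2 fun t => ?_, rfl⟩
    obtain ⟨t, ht⟩ := t
    obtain ⟨i, rfl⟩ := exists_index ⟨t, ht⟩
    rw [← unitSign_mul_lift y ht]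
    exact hbd _ _ (Fintype.mem_piFinset.1 hx i)

end Lift

/-! ### The functionals defining the arrangement of `D_n`. -/

section RootsD

variable {n : ℕ}

/-- Indices for the reflecting hyperplanes of `D_n`. -/
abbrev RootIndex (n : ℕ) : Type := {q : Fin n × Fin n // q.1 < q.2} × Bool

/-- The functionals `x_i - x_j` and `x_i + x_j` for `i < j`. -/
def rootD (n : ℕ) (r : RootIndex n) : E n →L[ℝ] ℝ :=
  EuclideanSpace.proj r.1.1.1 + (if r.2 then 1 else -1 : ℝ) • EuclideanSpace.proj r.1.1.2

theorem rootD_false (q : {q : Fin n × Fin n // q.1 < q.2}) (x : E n) :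
    rootD n (q, false) x = x q.1.1 - x q.1.2 := by
  simp [rootD, sub_eq_add_neg]

theorem rootD_true (q : {q : Fin n × Fin n // q.1 < q.2}) (x : E n) :
    rootD n (q, true) x = x q.1.1 + x q.1.2 := by
  simp [rootD]

theorem rootD_ne_zero (r : RootIndex n) : rootD n r ≠ 0 := by
  intro h
  have h1 : rootD n r (EuclideanSpace.single r.1.1.1 (1 : ℝ)) = 0 := by rw [h]; rfl
  have h2 : r.1.1.2 ≠ r.1.1.1 := r.1.2.ne'
  rcases r with ⟨q, _ | _⟩
  · rw [rootD_false] at h1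
    simp [h2] at h1
  · rw [rootD_true] at h1
    simp [h2] at h1

theorem kernels_rootD : kernels (rootD n) = arrangementD n := by
  ext H
  simp only [kernels, arrangementD, Finset.mem_image, Finset.mem_union, Finset.mem_filter,
    Finset.mem_univ, true_and]
  have hs : ∀ q : {q : Fin n × Fin n // q.1 < q.2},
      (rootD n (q, false)).ker = hyperplaneSub q.1.1 q.1.2 := by
    intro q
    ext x
    change rootD n (q, false) x = 0 ↔ x q.1.1 - x q.1.2 = 0
    rw [rootD_false]
  have ht : ∀ q : {q : Fin n × Fin n // q.1 < q.2},
      (rootD n (q, true)).ker = hyperplaneAdd q.1.1 q.1.2 := by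
    intro q
    ext x
    change rootD n (q, true) x = 0 ↔ x q.1.1 + x q.1.2 = 0
    rw [rootD_true]
  constructor
  · rintro ⟨⟨q, _ | _⟩, rfl⟩
    · exact .inl ⟨q.1, q.2, (hs q).symm⟩
    · exact .inr ⟨q.1, q.2, (ht q).symm⟩
  · rintro (⟨q, hq, rfl⟩ | ⟨q, hq, rfl⟩)
    · exact ⟨(⟨q, hq⟩, false), hs ⟨q, hq⟩⟩
    · exact ⟨(⟨q, hq⟩, true), ht ⟨q, hq⟩⟩

theorem forall_rootD {P : (E n → ℝ) → Prop} :
    (∀ r, P (rootD n r)) ↔ ∀ i j : Fin n, i < j →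
      P (fun x => x i - x j) ∧ P (fun x => x i + x j) := by
  have h1 : ∀ q, (⇑(rootD n (q, false)) : E n → ℝ) = fun x => x q.1.1 - x q.1.2 := fun q =>
    funext (rootD_false q)
  have h2 : ∀ q, (⇑(rootD n (q, true)) : E n → ℝ) = fun x => x q.1.1 + x q.1.2 := fun q =>
    funext (rootD_true q)
  constructor
  · intro h i j hij
    exact ⟨h1 ⟨(i, j), hij⟩ ▸ h (⟨(i, j), hij⟩, false), h2 ⟨(i, j), hij⟩ ▸ h (⟨(i, j), hij⟩, true)⟩
  · rintro h ⟨q, _ | _⟩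
    · exact h1 q ▸ (h q.1.1 q.1.2 q.2).1
    · exact h2 q ▸ (h q.1.1 q.1.2 q.2).2

theorem mem_flatThrough_rootD {p x : E n} :
    x ∈ flatThrough (rootD n) p ↔ Equations p ℝ x := by
  rw [mem_flatThrough]
  rw [forall_rootD (P := fun f => f p = 0 → f x = 0)]
  constructor
  · intro h i j hij
    rcases lt_or_gt_of_ne hij with hlt | hlt
    · obtain ⟨h1, h2⟩ := h i j hlt
      exact ⟨fun h => sub_eq_zero.1 (h1 (sub_eq_zero.2 h)),
        fun h => eq_neg_of_add_eq_zero_left (h2 (by simp [h]))⟩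
    · obtain ⟨h1, h2⟩ := h j i hlt
      exact ⟨fun h => (sub_eq_zero.1 (h1 (sub_eq_zero.2 h.symm))).symm,
        fun h => eq_neg_of_add_eq_zero_right (h2 (by simp [h]))⟩
  · intro h i j hij
    obtain ⟨h1, h2⟩ := h i j hij.ne
    exact ⟨fun h => sub_eq_zero.2 (h1 (sub_eq_zero.1 h)),
      fun h => by simp only [h2 (eq_neg_of_add_eq_zero_left h)]; ring⟩

theorem finrank_flatThrough_rootD (p : E n) :
    Module.finrank ℝ (flatThrough (rootD n) p) = (parameters p).card := by
  let φ : (parameters p → ℝ) →ₗ[ℝ] E n :=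
    { toFun := fun y => WithLp.toLp 2 (lift p y)
      map_add' := by
        intro y z
        ext i
        simp only [lift, PiLp.add_apply, Pi.add_apply]
        split_ifs <;> ring
      map_smul' := by
        intro c y
        ext i
        simp only [lift, PiLp.smul_apply, Pi.smul_apply, smul_eq_mul, RingHom.id_apply]
        split_ifs <;> ring }
  have hφ : Function.Injective φ := fun y z h => lift_injective (congrArg WithLp.ofLp h)
  have hr : φ.range = flatThrough (rootD n) p := by
    ext x
    rw [mem_flatThrough_rootD]
    constructor
    · rintro ⟨y, rfl⟩
      exact equations_lift y
    · intro hx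
      obtain ⟨y, hy⟩ := exists_lift_eq hx
      exact ⟨y, by ext i; exact congrFun hy i⟩
  rw [← hr, LinearMap.finrank_range_of_inj hφ]
  simp

/-- The integer points of the cube of side `2 m`. -/
def grid (n m : ℕ) : Finset (Fin n → ℤ) := Fintype.piFinset fun _ => Finset.Icc (-(m : ℤ)) m

/-- An integer vector as a point of Euclidean space. -/
def ofInt (x : Fin n → ℤ) : E n := WithLp.toLp 2 fun i => (x i : ℝ)

theorem ofInt_mem_flatThrough {p : E n} {x : Fin n → ℤ} :
    ofInt x ∈ flatThrough (rootD n) p ↔ Equations p ℤ x := by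
  rw [mem_flatThrough_rootD]
  simp only [Equations, ofInt]
  norm_cast

end RootsD

/-! ### Points in general position on a flat, and Möbius sums through a point. -/

section GenericPoint

variable {n : ℕ} {ι : Type*} [Fintype ι] {a : ι → E n →L[ℝ] ℝ}

/-- A flat is not covered by its finitely many proper intersections with the hyperplanes that do not
contain it. -/
theorem exists_flatThrough_eq (Y : {X // X ∈ intersections (kernels a)}) :
    ∃ p, flatThrough a p = flat Y := by
  obtain ⟨p, hp, h⟩ := Module.Dual.exists_forall_mem_ne_zero_of_forall_exists (flat Y)
    (fun i : {i // i ∉ vanishing a (flat Y)} => (a i : E n →ₗ[ℝ] ℝ)) (by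
      rintro ⟨i, hi⟩
      rw [mem_vanishing] at hi
      push Not at hi
      exact hi)
  refine ⟨p, ?_⟩
  rw [← zeroSpace_vanishing_flat Y, flatThrough]
  congr 1
  ext i
  rw [mem_zeroSet]
  exact ⟨fun h0 => by_contra fun hi => h ⟨i, hi⟩ h0, fun hi => mem_vanishing.1 hi p hp⟩

theorem sum_mobius_mem (p : E n) :
    ∑ Y : {X // X ∈ intersections (kernels a)} with p ∈ flat Y, mobius (kernels a) Y =
      if flatThrough a p = ⊤ then 1 else 0 := by
  obtain ⟨Z, hZ⟩ : ∃ Z : {X // X ∈ intersections (kernels a)}, flat Z = flatThrough a p :=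
    exists_flat_eq a (zeroSet a p)
  rw [← hZ, ← sum_mobius Z]
  refine Finset.sum_congr (Finset.filter_congr fun Y _ => ?_) fun _ _ => rfl
  rw [hZ]
  refine ⟨fun h => ?_, fun h => h (self_mem_flatThrough p)⟩
  rw [← zeroSpace_vanishing_flat Y, flatThrough, le_zeroSpace_iff]
  intro i hi
  exact mem_vanishing.2 fun y hy => hy i (mem_zeroSet.2 (mem_vanishing.1 hi p h))

theorem flatThrough_eq_top_iff (ha : ∀ i, a i ≠ 0) {p : E n} :
    flatThrough a p = ⊤ ↔ ∀ i, a i p ≠ 0 := by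
  constructor
  · intro h i hi
    refine ha i (ContinuousLinearMap.ext fun x => ?_)
    exact mem_flatThrough.1 (h ▸ Submodule.mem_top : x ∈ flatThrough a p) i hi
  · intro h
    exact eq_top_iff.2 fun x _ => mem_flatThrough.2 fun i hi => absurd hi (h i)

end GenericPoint

/-! ### Evaluation of the characteristic polynomial by counting grid points. -/

section CharPolyD

variable {n : ℕ}

/-- Replacing `(2m+1)^(dim Y)` by the number of grid points of `Y` and exchanging sums leaves, at
each grid point, the sum of `μ` over the flats through it. This is one off the hyperplanes and zero
on them. -/
theorem eval_charPoly_rootD (m : ℕ) :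
    (charPoly (kernels (rootD n))).eval (2 * (m : ℤ) + 1) =
      (absInjective n (Finset.Icc (-(m : ℤ)) m)).card := by
  have h1 : ∀ Y : {X // X ∈ intersections (kernels (rootD n))},
      (2 * (m : ℤ) + 1) ^ Module.finrank ℝ (flat Y) =
        ((grid n m).filter fun x => ofInt x ∈ flat Y).card := by
    intro Y
    obtain ⟨p, hp⟩ := exists_flatThrough_eq Y
    rw [← hp, finrank_flatThrough_rootD]
    have := card_equations p m
    simp only [ofInt_mem_flatThrough]
    rw [grid, this]
    push_cast
    rfl
  rw [charPoly_eq, eval_finsetSum]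
  simp only [eval_mul, eval_C, eval_pow, eval_X, h1]
  have h2 : ∀ Y : {X // X ∈ intersections (kernels (rootD n))},
      mobius (kernels (rootD n)) Y * (((grid n m).filter fun x => ofInt x ∈ flat Y).card : ℤ) =
      ∑ x ∈ grid n m, if ofInt x ∈ flat Y then mobius (kernels (rootD n)) Y else 0 := by
    intro Y
    rw [← Finset.sum_filter, Finset.sum_const, nsmul_eq_mul, mul_comm]
  simp only [h2]
  rw [Finset.sum_comm]
  simp only [← Finset.sum_filter, sum_mobius_mem]
  rw [Finset.sum_const, nsmul_eq_mul, mul_one]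
  congr 2
  rw [grid]
  refine Finset.filter_congr fun x _ => ?_
  rw [flatThrough_eq_top_iff rootD_ne_zero, forall_rootD (P := fun f => f (ofInt x) ≠ 0)]
  constructor
  · intro h i j hij
    by_contra hne
    have hx : x i = x j ∨ x i = -x j := Int.natAbs_eq_natAbs_iff.1 hij
    have key : ∀ i j, i < j → x i ≠ x j ∧ x i ≠ -x j := by
      intro i j hlt
      obtain ⟨h1, h2⟩ := h i j hlt
      refine ⟨fun h => h1 ?_, fun h => h2 ?_⟩
      · simp [ofInt, h]
      · simp [ofInt, h]
    rcases lt_or_gt_of_ne hne with hlt | hlt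
    · have := key i j hlt
      tauto
    · have := key j i hlt
      omega
  · intro h i j hij
    have hne : (x i).natAbs ≠ (x j).natAbs := fun h' => hij.ne (h h')
    rw [ne_eq, Int.natAbs_eq_natAbs_iff, not_or] at hne
    refine ⟨fun h0 => hne.1 ?_, fun h0 => hne.2 ?_⟩
    · have : (x i : ℝ) - x j = 0 := h0
      exact_mod_cast sub_eq_zero.1 this
    · have : (x i : ℝ) + x j = 0 := h0
      exact_mod_cast eq_neg_of_add_eq_zero_left this

theorem charPoly_arrangementD (hn : 1 ≤ n) :
    charPoly (arrangementD n) =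
      (∏ i ∈ Finset.range (n - 1), (X - C (2 * (i : ℤ) + 1))) * (X - C ((n : ℤ) - 1)) := by
  rw [← kernels_rootD]
  obtain ⟨n, rfl⟩ := Nat.exists_eq_add_of_le' hn
  apply Polynomial.eq_of_infinite_eval_eq
  refine Set.infinite_of_injective_forall_mem (f := fun m : ℕ => 2 * (m : ℤ) + 1)
    (fun x y h => by simpa using h) fun m => ?_
  rw [Set.mem_ofPred_eq, eval_charPoly_rootD, card_absInjective_of_mem n _ m]
  · rw [eval_mul, eval_prod]
    simp only [eval_sub, eval_X, eval_C, Nat.add_sub_cancel]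
    push_cast
    congr 1
    · refine Finset.prod_congr rfl fun i _ => ?_
      ring
    · ring
  · intro b hb
    rw [Finset.mem_Icc] at hb ⊢
    constructor <;> linarith
  · rw [Finset.mem_Icc]
    constructor <;> linarith
  · rw [Int.card_Icc]
    omega

end CharPolyD

/-! ### Isometries permuting the hyperplanes, and equivariance of projections. -/

section Symmetries

variable {n : ℕ} {ι : Type*} (a : ι → E n →L[ℝ] ℝ)

/-- `g` permutes the functionals up to sign. -/
def Permutes (g : E n ≃ₗᵢ[ℝ] E n) : Prop :=
  ∀ i, ∃ j, (∀ x, a i (g x) = a j x) ∨ ∀ x, a i (g x) = -a j x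

variable {a} {g : E n ≃ₗᵢ[ℝ] E n}

theorem Permutes.signOn_eq [Fintype ι] (hg : Permutes a g) {p q : E n}
    (h : signOn a Finset.univ p = signOn a Finset.univ q) :
    signOn a Finset.univ (g p) = signOn a Finset.univ (g q) := by
  ext i
  obtain ⟨j, hj | hj⟩ := hg i
  · have := congrFun h j
    simpa only [signOn_univ, hj] using this
  · have := congrFun h j
    rw [signOn_univ, signOn_univ] at this ⊢
    rw [hj, hj, Left.sign_neg, Left.sign_neg, this]

variable [Fintype ι]

theorem mem_cone_signOn_univ_iff {p z : E n} :
    z ∈ cone a (signOn a Finset.univ p) ↔ ∀ i, 0 ≤ a i p * a i z := by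
  refine forall_congr' fun i => ?_
  rw [signOn_univ]
  rcases lt_trichotomy (a i p) 0 with h | h | h
  · rw [sign_neg h, ← neg_mul_neg (a i p), mul_nonneg_iff_of_pos_left (neg_pos.2 h)]
    simp
  · simp [h]
  · rw [sign_pos h]
    simp [h]

theorem Permutes.map_mem_cone (hg : Permutes a g) {p z : E n}
    (hz : z ∈ cone a (signOn a Finset.univ p)) : g z ∈ cone a (signOn a Finset.univ (g p)) := by
  rw [mem_cone_signOn_univ_iff] at hz ⊢
  intro i
  obtain ⟨j, hj | hj⟩ := hg i
  · rw [hj, hj]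
    exact hz j
  · rw [hj, hj, neg_mul_neg]
    exact hz j

theorem Permutes.map_mem_flatThrough (hg : Permutes a g) {p z : E n}
    (hz : z ∈ flatThrough a p) : g z ∈ flatThrough a (g p) := by
  rw [mem_flatThrough] at hz ⊢
  intro i
  obtain ⟨j, hj | hj⟩ := hg i
  · rw [hj, hj]
    exact hz j
  · rw [hj, hj, neg_eq_zero, neg_eq_zero]
    exact hz j

theorem Permutes.finrank_flatThrough_le (hg : Permutes a g) (p : E n) :
    Module.finrank ℝ (flatThrough a p) ≤ Module.finrank ℝ (flatThrough a (g p)) := by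
  rw [← LinearEquiv.finrank_map_eq g.toLinearEquiv (flatThrough a p)]
  refine Submodule.finrank_mono ?_
  rintro _ ⟨z, hz, rfl⟩
  exact hg.map_mem_flatThrough hz

theorem Permutes.finrank_flatThrough (hg : Permutes a g) (hg' : Permutes a g⁻¹) (p : E n) :
    Module.finrank ℝ (flatThrough a (g p)) = Module.finrank ℝ (flatThrough a p) := by
  refine le_antisymm ?_ (hg.finrank_flatThrough_le p)
  have h := hg'.finrank_flatThrough_le (g p)
  rwa [show g⁻¹ (g p) = p from g.symm_apply_apply p] at h

theorem Permutes.proj_eq (hg : Permutes a g) (hg' : Permutes a g⁻¹) (p x : E n) :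
    proj a (signOn a Finset.univ (g p)) (g x) = g (proj a (signOn a Finset.univ p) x) := by
  rw [← isProjection_cone_iff]
  obtain ⟨h1, h2⟩ := isProjection_proj (a := a) (signOn a Finset.univ p) x
  refine ⟨hg.map_mem_cone h1, fun z hz => ?_⟩
  have h3 := hg'.map_mem_cone hz
  rw [show g⁻¹ (g p) = p from g.symm_apply_apply p] at h3
  have h4 := h2 _ h3
  rw [g.dist_map]
  refine h4.trans_eq ?_
  rw [← g.dist_map, show g (g⁻¹ z) = z from g.apply_symm_apply z]

theorem hasProjectionDim_cone_iff {s : ι → SignType} (hs : ∀ i, s i ≠ 0) {k : ℕ} {y : E n} :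
    HasProjectionDim (cone a s) k y ↔
      Module.finrank ℝ (flatThrough a (proj a s y)) = k := by
  constructor
  · rintro ⟨q, hq, hk⟩
    rw [isProjection_cone_iff.1 hq]
    exact ((inRelintOfFace_cone_iff hs).1 hk).2
  · intro h
    exact ⟨_, isProjection_proj s y, (inRelintOfFace_cone_iff hs).2 ⟨(isProjection_proj s y).1, h⟩⟩

end Symmetries

/-! ### Simple transitivity of `D_n` on its chambers. -/

section GroupD

variable {n : ℕ}

theorem mem_groupD {g : E n ≃ₗᵢ[ℝ] E n} :
    g ∈ groupD n ↔ ∃ (σ : Equiv.Perm (Fin n)) (ε : Fin n → ℤˣ), ∏ i, ε i = 1 ∧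
      ∀ (x : E n) (i : Fin n), g x i = ((ε i : ℤ) : ℝ) * x (σ i) := Iff.rfl

theorem exists_rootD_eq (i j : Fin n) (hij : i ≠ j) (u v : ℤˣ) :
    ∃ r, (∀ x : E n, ((u : ℤ) : ℝ) * x i + ((v : ℤ) : ℝ) * x j = rootD n r x) ∨
      ∀ x : E n, ((u : ℤ) : ℝ) * x i + ((v : ℤ) : ℝ) * x j = -rootD n r x := by
  have main : ∀ i j : Fin n, i < j → ∀ u v : ℤˣ,
      ∃ r, (∀ x : E n, ((u : ℤ) : ℝ) * x i + ((v : ℤ) : ℝ) * x j = rootD n r x) ∨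
      ∀ x : E n, ((u : ℤ) : ℝ) * x i + ((v : ℤ) : ℝ) * x j = -rootD n r x := by
    intro i j hij u v
    rcases Int.units_eq_one_or u with rfl | rfl <;> rcases Int.units_eq_one_or v with rfl | rfl
    · exact ⟨(⟨(i, j), hij⟩, true), .inl fun x => by rw [rootD_true]; simp⟩
    · exact ⟨(⟨(i, j), hij⟩, false), .inl fun x => by rw [rootD_false]; simp [sub_eq_add_neg]⟩
    · exact ⟨(⟨(i, j), hij⟩, false), .inr fun x => by rw [rootD_false]; simp; ring⟩
    · exact ⟨(⟨(i, j), hij⟩, true), .inr fun x => by rw [rootD_true]; simp; ring⟩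
  rcases lt_or_gt_of_ne hij with h | h
  · exact main i j h u v
  · obtain ⟨r, hr⟩ := main j i h v u
    refine ⟨r, hr.imp (fun h x => ?_) fun h x => ?_⟩
    · rw [add_comm, h]
    · rw [add_comm, h]

theorem permutes_rootD {g : E n ≃ₗᵢ[ℝ] E n} (hg : g ∈ groupD n) : Permutes (rootD n) g := by
  obtain ⟨σ, ε, -, hg⟩ := mem_groupD.1 hg
  rintro ⟨⟨⟨i, j⟩, hij⟩, _ | _⟩
  · obtain ⟨r, hr⟩ := exists_rootD_eq (σ i) (σ j) (σ.injective.ne hij.ne) (ε i) (-ε j)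
    refine ⟨r, hr.imp (fun h x => ?_) fun h x => ?_⟩ <;>
    · rw [← h, rootD_false, hg, hg]
      push_cast
      ring
  · obtain ⟨r, hr⟩ := exists_rootD_eq (σ i) (σ j) (σ.injective.ne hij.ne) (ε i) (ε j)
    refine ⟨r, hr.imp (fun h x => ?_) fun h x => ?_⟩ <;>
    rw [← h, rootD_true, hg, hg]

/-- The signed permutation `x ↦ (ε_i x_{σ i})_i`. -/
def signedPerm (σ : Equiv.Perm (Fin n)) (ε : Fin n → ℤˣ) : E n ≃ₗᵢ[ℝ] E n where
  toFun x := WithLp.toLp 2 fun i => ((ε i : ℤ) : ℝ) * x (σ i)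
  invFun x := WithLp.toLp 2 fun i => ((ε (σ.symm i) : ℤ) : ℝ) * x (σ.symm i)
  map_add' x y := by
    ext i
    simp [mul_add]
  map_smul' c x := by
    ext i
    simp [mul_left_comm]
  left_inv x := by
    ext i
    simp [← mul_assoc, ← Int.cast_mul]
  right_inv x := by
    ext i
    simp [← mul_assoc, ← Int.cast_mul]
  norm_map' x := by
    have h : ∀ u : ℤˣ, |((u : ℤ) : ℝ)| = 1 := fun u => by
      rcases Int.units_eq_one_or u with rfl | rfl <;> simp
    simp only [EuclideanSpace.norm_eq, LinearEquiv.coe_mk, LinearMap.coe_mk, AddHom.coe_mk,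
      norm_mul, Real.norm_eq_abs, h, one_mul]
    congr 1
    exact Equiv.sum_comp σ fun i => |x i| ^ 2

/-- Points in the open chamber `|x_1| < x_2 < ... < x_n`. -/
def IsDominant (p : E n) : Prop := ∀ i j, i < j → |p i| < p j

theorem isDominant_iff {p : E n} :
    IsDominant p ↔ ∀ r : RootIndex n, signOn (rootD n) Finset.univ p r = if r.2 then 1 else -1 := by
  constructor
  · rintro h ⟨⟨⟨i, j⟩, hij⟩, _ | _⟩
    · have := abs_lt.1 (h i j hij)
      rw [signOn_univ, rootD_false]
      exact sign_neg (by simp only; linarith)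
    · have := abs_lt.1 (h i j hij)
      rw [signOn_univ, rootD_true]
      exact sign_pos (by simp only; linarith)
  · intro h i j hij
    have h1 := h (⟨(i, j), hij⟩, false)
    have h2 := h (⟨(i, j), hij⟩, true)
    rw [signOn_univ, rootD_false] at h1
    rw [signOn_univ, rootD_true] at h2
    have h1 := sign_eq_neg_one_iff.1 h1
    have h2 := sign_eq_one_iff.1 h2
    simp only at h1 h2
    exact abs_lt.2 ⟨by linarith, by linarith⟩

theorem IsDominant.signOn_eq {p q : E n} (hp : IsDominant p) (hq : IsDominant q) :
    signOn (rootD n) Finset.univ p = signOn (rootD n) Finset.univ q :=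
  funext fun r => (isDominant_iff.1 hp r).trans (isDominant_iff.1 hq r).symm

theorem IsDominant.congr {p q : E n} (hp : IsDominant p)
    (h : signOn (rootD n) Finset.univ p = signOn (rootD n) Finset.univ q) : IsDominant q :=
  isDominant_iff.2 fun r => h ▸ isDominant_iff.1 hp r

/-- Every regular point is mapped into the dominant chamber by an element of `D_n`. -/
theorem exists_isDominant {p : E (n + 1)} (hp : ∀ r, rootD (n + 1) r p ≠ 0) :
    ∃ g ∈ groupD (n + 1), IsDominant (g p) := by
  rw [forall_rootD (P := fun f => f p ≠ 0)] at hp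
  have hne : ∀ i j, i < j → |p i| ≠ |p j| := by
    intro i j hij h
    obtain ⟨h1, h2⟩ := hp i j hij
    rcases abs_eq_abs.1 h with h | h
    · exact h1 (sub_eq_zero.2 h)
    · exact h2 (by simp only [h]; ring)
  have hinj : Function.Injective fun i => |p i| := by
    intro i j h
    by_contra hij
    rcases lt_or_gt_of_ne hij with hlt | hlt
    · exact hne i j hlt h
    · exact hne j i hlt h.symm
  let σ := Tuple.sort fun i => |p i|
  have hmono : StrictMono fun i => |p (σ i)| :=
    (Tuple.monotone_sort fun i => |p i|).strictMono_of_injective (hinj.comp σ.injective)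
  let e : Fin (n + 1) → ℤˣ := fun i => if p (σ i) < 0 then -1 else 1
  have he : ∀ i, ((e i : ℤ) : ℝ) * p (σ i) = |p (σ i)| := by
    intro i
    by_cases h : p (σ i) < 0
    · simp [e, h, abs_of_neg h]
    · simp [e, h, abs_of_nonneg (not_lt.1 h)]
  -- Multiplying the sign at coordinate `0` by the total product makes the product one. Dominance is
  -- unaffected, since that coordinate enters only through its absolute value.
  let ε : Fin (n + 1) → ℤˣ := fun i => e i * if i = 0 then ∏ j, e j else 1
  refine ⟨signedPerm σ ε, ⟨σ, ε, ?_, fun _ _ => rfl⟩, fun i j hij => ?_⟩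
  · simp only [ε]
    rw [Finset.prod_mul_distrib, Finset.prod_ite_eq' Finset.univ, if_pos (Finset.mem_univ _)]
    exact Int.units_mul_self _
  · have hval : ∀ i, signedPerm σ ε p i = ((ε i : ℤ) : ℝ) * p (σ i) := fun _ => rfl
    have habs : |((ε i : ℤ) : ℝ)| = 1 := by
      rcases Int.units_eq_one_or (ε i) with h | h <;> rw [h] <;> simp
    have hj : ε j = e j := by
      simp only [ε]
      rw [if_neg (Fin.ne_zero_of_lt hij), mul_one]
    rw [hval, hval, hj, he, abs_mul, habs, one_mul]
    exact hmono hij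

/-- The absolute values of a dominant point increase strictly, so the permutation is increasing,
hence trivial. All coordinates but `0` are positive, so their signs are `1`, and the product
condition settles the last sign. -/
theorem eq_one_of_isDominant {g : E (n + 1) ≃ₗᵢ[ℝ] E (n + 1)} (hg : g ∈ groupD (n + 1))
    {p : E (n + 1)} (hp : IsDominant p) (hgp : IsDominant (g p)) : g = 1 := by
  obtain ⟨σ, ε, hε, hg⟩ := mem_groupD.1 hg
  have hpos : ∀ {q : E (n + 1)}, IsDominant q → ∀ j ≠ 0, 0 < q j := fun hq j hj =>
    (abs_nonneg _).trans_lt (hq 0 j (Fin.pos_iff_ne_zero.2 hj))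
  have hmono : ∀ {q : E (n + 1)}, IsDominant q → StrictMono fun i => |q i| := fun hq i j hij =>
    (hq i j hij).trans_le (le_abs_self _)
  have habs : ∀ i, |g p i| = |p (σ i)| := by
    intro i
    rw [hg, abs_mul]
    rcases Int.units_eq_one_or (ε i) with h | h <;> rw [h] <;> simp
  have hσ : StrictMono σ := by
    intro i j hij
    have h := hmono hgp hij
    simp only [habs] at h
    exact (hmono hp).lt_iff_lt.1 h
  have hσ1 : ∀ i, σ i = i := fun i => by
    have h := Subsingleton.elim (hσ.orderIsoOfSurjective σ σ.surjective) (OrderIso.refl _)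
    exact DFunLike.congr_fun h i
  have hε1 : ∀ j ≠ 0, ε j = 1 := by
    intro j hj
    have h1 := hpos hgp j hj
    have h2 := hpos hp j hj
    rw [hg, hσ1] at h1
    refine (Int.units_eq_one_or (ε j)).resolve_right fun h => ?_
    rw [h] at h1
    simp at h1
    linarith
  have hε0 : ε 0 = 1 := by
    rw [← hε, Fin.prod_univ_succ, Finset.prod_eq_one fun i _ => hε1 _ (Fin.succ_ne_zero i), mul_one]
  ext x i
  rw [hg, hσ1, show ε i = 1 from (eq_or_ne i 0).elim (fun h => h ▸ hε0) (hε1 i)]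
  simp

/-- Take `d` moving `p` into the dominant chamber. The conjugate of `g * h⁻¹` by `d` maps a dominant
point to a dominant point, so it is trivial. -/
theorem eq_of_signOn_eq {g h : E (n + 1) ≃ₗᵢ[ℝ] E (n + 1)} (hg : g ∈ groupD (n + 1))
    (hh : h ∈ groupD (n + 1)) {p : E (n + 1)} (hp : ∀ r, rootD (n + 1) r p ≠ 0)
    (hs : signOn (rootD (n + 1)) Finset.univ (g⁻¹ p) =
      signOn (rootD (n + 1)) Finset.univ (h⁻¹ p)) : g = h := by
  obtain ⟨d, hd, hdp⟩ := exists_isDominant hp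
  have h1 : signOn (rootD (n + 1)) Finset.univ (d p) =
      signOn (rootD (n + 1)) Finset.univ ((d * g * h⁻¹ * d⁻¹) (d p)) := by
    have h2 := (permutes_rootD (mul_mem hd hg)).signOn_eq hs
    have h3 : (d * g) (g⁻¹ p) = d p := congrArg d (g.apply_symm_apply p)
    have h4 : (d * g * h⁻¹ * d⁻¹) (d p) = (d * g) (h⁻¹ p) :=
      congrArg (fun y => (d * g) (h⁻¹ y)) (d.symm_apply_apply p)
    rw [h4, ← h2, h3]
  have h2 := eq_one_of_isDominant (mul_mem (mul_mem (mul_mem hd hg) (inv_mem hh)) (inv_mem hd))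
    hdp (hdp.congr h1)
  have h3 : g * h⁻¹ = 1 := by
    have : g * h⁻¹ = d⁻¹ * (d * g * h⁻¹ * d⁻¹) * d := by group
    rw [this, h2]
    group
  exact mul_inv_eq_one.1 h3

theorem exists_signOn_eq {p q : E (n + 1)} (hp : ∀ r, rootD (n + 1) r p ≠ 0)
    (hq : ∀ r, rootD (n + 1) r q ≠ 0) : ∃ g ∈ groupD (n + 1),
      signOn (rootD (n + 1)) Finset.univ (g⁻¹ p) = signOn (rootD (n + 1)) Finset.univ q := by
  obtain ⟨c, hc, hcp⟩ := exists_isDominant hp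
  obtain ⟨d, hd, hdq⟩ := exists_isDominant hq
  refine ⟨c⁻¹ * d, mul_mem (inv_mem hc) hd, ?_⟩
  have h := (permutes_rootD (inv_mem hd)).signOn_eq (hcp.signOn_eq hdq)
  rw [show d⁻¹ (d q) = q from d.symm_apply_apply q] at h
  rw [← h, mul_inv_rev, inv_inv]
  rfl

/-- Elements of `D_n` correspond to chambers, and the dimension of the projection of `g x` to a
fixed chamber is that of the projection of `x` to the chamber corresponding to `g`. -/
theorem ncard_hasProjectionDim (hn : 1 ≤ n) {s : RootIndex n → SignType}
    (hs : s ∈ chambers (rootD n) Finset.univ) (x : E n) (k : ℕ) :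
    {g : E n ≃ₗᵢ[ℝ] E n | g ∈ groupD n ∧ HasProjectionDim (cone (rootD n) s) k (g x)}.ncard =
      ((chambers (rootD n) Finset.univ).filter fun s =>
        Module.finrank ℝ (flatThrough (rootD n) (proj (rootD n) s x)) = k).card := by
  obtain ⟨n, rfl⟩ := Nat.exists_eq_add_of_le' hn
  obtain ⟨⟨p, rfl⟩, hs0⟩ := mem_chambers.1 hs
  have hreg : ∀ {q : E (n + 1)}, (∀ r ∈ Finset.univ, signOn (rootD (n + 1)) Finset.univ q r ≠ 0) →
      ∀ r, rootD (n + 1) r q ≠ 0 := by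
    intro q hq r h0
    refine hq r (Finset.mem_univ r) ?_
    rw [signOn_univ, h0, sign_zero]
  have hp := hreg hs0
  have hdim : ∀ g ∈ groupD (n + 1), (HasProjectionDim
      (cone (rootD (n + 1)) (signOn (rootD (n + 1)) Finset.univ p)) k (g x) ↔
      Module.finrank ℝ (flatThrough (rootD (n + 1))
        (proj (rootD (n + 1)) (signOn (rootD (n + 1)) Finset.univ (g⁻¹ p)) x)) = k) := by
    intro g hg
    have hg1 := permutes_rootD hg
    have hg2 := permutes_rootD (inv_mem hg)
    rw [hasProjectionDim_cone_iff fun i => hs0 i (Finset.mem_univ i),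
      ← hg1.finrank_flatThrough hg2 (proj _ _ x), ← hg1.proj_eq hg2,
      show g (g⁻¹ p) = p from g.apply_symm_apply p]
  rw [← Set.ncard_coe_finset]
  refine Set.ncard_congr (fun g _ => signOn (rootD (n + 1)) Finset.univ (g⁻¹ p)) ?_ ?_ ?_
  · rintro g ⟨hg, hk⟩
    refine Finset.mem_coe.2 (Finset.mem_filter.2 ⟨mem_chambers.2 ⟨⟨_, rfl⟩, fun r _ => ?_⟩,
      (hdim g hg).1 hk⟩)
    rw [signOn_univ]
    obtain ⟨j, hj | hj⟩ := permutes_rootD (inv_mem hg) r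
    · rw [hj]
      exact sign_ne_zero.2 (hp j)
    · rw [hj]
      exact sign_ne_zero.2 (neg_ne_zero.2 (hp j))
  -- Injectivity and surjectivity of `g ↦ g⁻¹ K` are the freeness and transitivity of the action.
  · rintro g h ⟨hg, _⟩ ⟨hh, _⟩ hgh
    exact eq_of_signOn_eq hg hh hp hgh
  · intro t ht
    obtain ⟨ht, hk⟩ := Finset.mem_filter.1 (Finset.mem_coe.1 ht)
    obtain ⟨⟨q, rfl⟩, hq0⟩ := mem_chambers.1 ht
    obtain ⟨g, hg, h⟩ := exists_signOn_eq hp (hreg hq0)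
    exact ⟨g, ⟨hg, (hdim g hg).2 (h ▸ hk)⟩, h⟩

end GroupD
end CoxeterD

end

/-! ### The factorization and the projection count combined. -/

theorem theorem3p4 (n : ℕ) (hn : 1 ≤ n) :
    CoxeterD.charPoly (CoxeterD.arrangementD n) =
        (∏ i ∈ Finset.range (n - 1), (X - C (2 * (i : ℤ) + 1))) * (X - C ((n : ℤ) - 1)) ∧
      ∃ 𝓗 : Finset (Submodule ℝ (CoxeterD.E n)), (∀ H ∈ 𝓗, H ≠ ⊤) ∧
        ∀ K : Set (CoxeterD.E n), CoxeterD.IsClosedChamber (CoxeterD.arrangementD n) K →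
          ∀ x ∈ K, (∀ H ∈ 𝓗, x ∉ H) →
            ∀ k : ℕ,
              (({g : CoxeterD.E n ≃ₗᵢ[ℝ] CoxeterD.E n | g ∈ CoxeterD.groupD n ∧
                  CoxeterD.HasProjectionDim K k (g x)}.ncard : ℕ) : ℤ) =
                |(CoxeterD.charPoly (CoxeterD.arrangementD n)).coeff k| := by
  refine ⟨CoxeterD.charPoly_arrangementD hn, CoxeterD.exceptional (CoxeterD.rootD n),
    fun H hH => (Finset.mem_filter.1 hH).2, fun K hK x _ hx k => ?_⟩
  rw [← CoxeterD.kernels_rootD] at hK ⊢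
  obtain ⟨s, hs, rfl⟩ := hK.exists_eq_cone
  rw [CoxeterD.ncard_hasProjectionDim hn hs,
    CoxeterD.card_finrank_flatThrough_proj CoxeterD.rootD_ne_zero
      (CoxeterD.isGeneric_of_forall_notMem hx)]
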